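/- Let $q\in\mathbb{C}$ with $0<|q|<1$, and fix a square root $q^{1/2}$ of $q$ (with $q^{-1/2}=1/q^{1/2}$). For a meromorphic function $f$ in $\mathbb{C}$ and $x=(z+z^{-1})/2\neq\pm1$, put $$(\mathcal{D}_qf)(x)=\frac{f(\hat x)-f(\check x)}{\hat x-\check x},\qquad \hat x=\frac{q^{1/2}z+q^{-1/2}z^{-1}}{2},\quad \check x=\frac{q^{-1/2}z+q^{1/2}z^{-1}}{2},$$ and $(\mathcal{D}_qf)(\pm1)=f'(\pm(q^{1/2}+q^{-1/2})/2)$; this does not depend on which of $z,1/z$ is used. Let $\varphi,s:(R_0,\infty)\to(0,\infty)$ be non-decreasing, $\varphi$ unbounded, such that $\log r\le\varphi(r)\le r$ and $r<s(r)\le r^2$ for all large $r$, and $\liminf_{r\to\infty}s(r)/r>1$. Put $$\alpha_{\varphi,s}=\liminf_{r\to\infty}\frac{\log\varphi(r)}{\log\varphi(s(r))},\qquad \gamma_{\varphi,s}=\liminf_{r\to\infty}\frac{\log\log\frac{s(r)}{r}}{\log\varphi(r)},\qquad \rho_\varphi(f)=\limsup_{r\to\infty}\frac{\log T(r,f)}{\log\varphi(r)},$$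 where $T(r,f)$ is the Nevanlinna characteristic of $f$. Let $f$ be a meromorphic function in $\mathbb{C}$ of finite $\varphi$-order $\rho_\varphi(f)$ such that $\mathcal{D}_qf\not\equiv0$. Assume that $\alpha_{\varphi,s}>0$, that $\varphi$ is continuous, and that $\log\varphi(r)/\log r\to0$ as $r\to\infty$. Let $\varepsilon>0$, and write $r=|x|$. (a) If $\limsup_{r\to\infty}s(r)/r=\infty$ and $s$ is convex and differentiable, then $$\log^+\left|\frac{\mathcal{D}_qf(x)}{f(x)}\right|=O\left(\frac{\varphi(s(r))^{\rho_\varphi(f)+\varepsilon/2}}{\log\frac{s(r)}{r}}+1\right)=O\left(\varphi(s(r))^{\rho_\varphi(f)-\alpha_{\varphi,s}\gamma_{\varphi,s}+\varepsilon}\right)$$ as $r=|x|\to\infty$ outside an exceptional set $E$ of radii of finite logarithmic measure, that is, $\int_{E\cap[1,\infty)}dt/t<\infty$. (b) If $\limsup_{r\to\infty}s(r)/r<\infty$ and $\varphi$ is subadditive, that is, $\varphi(a+b)\le\varphi(a)+\varphi(b)$ for all large $a,b$, then $$\log^+\left|\frac{\mathcal{D}_qf(x)}{f(x)}\right|=O\left(\varphi(r)^{\rho_\varphi(f)+\varepsilon}\right)$$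 as $r=|x|\to\infty$ outside an exceptional set of radii of finite logarithmic measure. -/

import Mathlib

open Filter Set MeasureTheory Topology Asymptotics

/-- The branch `z = x + √(x² - 1)` of the solution of `x = (z + 1/z) / 2`. -/
noncomputable def awZ (x : ℂ) : ℂ := x + (x ^ 2 - 1) ^ (1 / 2 : ℂ)

/-- The point `x̂ = (q^{1/2} z + q^{-1/2} z⁻¹) / 2`, where `p` stands for `q^{1/2}`. -/
noncomputable def awHat (p z : ℂ) : ℂ := (p * z + p⁻¹ * z⁻¹) / 2

/-- The point `x̌ = (q^{-1/2} z + q^{1/2} z⁻¹) / 2`, where `p` stands for `q^{1/2}`. -/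
noncomputable def awCheck (p z : ℂ) : ℂ := (p⁻¹ * z + p * z⁻¹) / 2

open Classical in
/-- The Askey-Wilson divided difference operator `𝒟_q`, where `p` stands for the fixed square
root `q^{1/2}`. By `awOperator_eq` below, the choice between `z` and `1/z` does not matter. -/
noncomputable def awOperator (p : ℂ) (f : ℂ → ℂ) (x : ℂ) : ℂ :=
  if x = 1 ∨ x = -1 then deriv f (x * (p + p⁻¹) / 2)
  else (f (awHat p (awZ x)) - f (awCheck p (awZ x))) /
    (awHat p (awZ x) - awCheck p (awZ x))

theorem awZ_mul (x : ℂ) : awZ x * (x - (x ^ 2 - 1) ^ (1 / 2 : ℂ)) = 1 := by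
  have h : ((x ^ 2 - 1) ^ (1 / 2 : ℂ)) ^ 2 = x ^ 2 - 1 := by
    rw [one_div]
    exact Complex.cpow_nat_inv_pow _ two_ne_zero
  unfold awZ
  linear_combination -h

theorem awZ_spec (x : ℂ) : awZ x ≠ 0 ∧ (awZ x + (awZ x)⁻¹) / 2 = x := by
  have h := awZ_mul x
  refine ⟨left_ne_zero_of_mul_eq_one h, ?_⟩
  rw [inv_eq_of_mul_eq_one_right h]
  unfold awZ
  ring

/-- Away from `±1` the operator may be computed with either solution `z` of
`x = (z + 1/z) / 2`. -/
theorem awOperator_eq (p : ℂ) (f : ℂ → ℂ) {x z : ℂ} (h1 : x ≠ 1) (h2 : x ≠ -1) (hz : z ≠ 0)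
    (hx : (z + z⁻¹) / 2 = x) :
    awOperator p f x = (f (awHat p z) - f (awCheck p z)) / (awHat p z - awCheck p z) := by
  obtain ⟨hw, hwx⟩ := awZ_spec x
  rw [awOperator, if_neg (by tauto)]
  have key : (z - awZ x) * (z - (awZ x)⁻¹) = 0 := by
    have e : z + z⁻¹ = awZ x + (awZ x)⁻¹ := by
      linear_combination 2 * hx - 2 * hwx
    have e1 : z * z⁻¹ = 1 := mul_inv_cancel₀ hz
    have e2 : awZ x * (awZ x)⁻¹ = 1 := mul_inv_cancel₀ hw
    linear_combination z * e - e1 + e2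
  rcases mul_eq_zero.1 key with h | h
  · rw [sub_eq_zero.1 h]
  · have e : awHat p z = awCheck p (awZ x) ∧ awCheck p z = awHat p (awZ x) := by
      rw [sub_eq_zero.1 h]
      constructor <;> simp only [awHat, awCheck, inv_inv] <;> ring
    rw [e.1, e.2, ← neg_sub (f (awHat p (awZ x))), ← neg_sub (awHat p (awZ x)), neg_div_neg_eq]

/-- The `φ`-order `limsup_{r → ∞} log T(r, f) / log φ(r)` of a meromorphic function, where
`T(r, f)` is the Nevanlinna characteristic. -/
noncomputable def phiOrder (φ : ℝ → ℝ) (f : ℂ → ℂ) : EReal :=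
  limsup (fun r : ℝ =>
    ((Real.log (ValueDistribution.characteristic f ⊤ r) / Real.log (φ r) : ℝ) : EReal)) atTop

/-- `α_{φ,s} = liminf_{r → ∞} log φ(r) / log φ(s(r))`. -/
noncomputable def growthAlpha (φ s : ℝ → ℝ) : EReal :=
  liminf (fun r : ℝ => ((Real.log (φ r) / Real.log (φ (s r)) : ℝ) : EReal)) atTop

/-- `γ_{φ,s} = liminf_{r → ∞} log log (s(r)/r) / log φ(r)`. -/
noncomputable def growthGamma (φ s : ℝ → ℝ) : EReal :=
  liminf (fun r : ℝ => ((Real.log (Real.log (s r / r)) / Real.log (φ r) : ℝ) : EReal)) atTop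

/-- Sets of radii of finite logarithmic measure: `∫_{E ∩ [1,∞)} dt/t < ∞`. -/
def FiniteLogMeasure (E : Set ℝ) : Prop :=
  MeasurableSet E ∧ ∫⁻ t in E ∩ Ici 1, ENNReal.ofReal (1 / t) < ⊤

/-- The filter of points `x ∈ ℂ` with `|x| → ∞`, `|x| ∉ E`. -/
noncomputable def cobddOutside (E : Set ℝ) : Filter ℂ :=
  Bornology.cobounded ℂ ⊓ 𝓟 {x : ℂ | ‖x‖ ∉ E}

/-! Once `|x̂ - x̌| ≥ 1`, the quantity `log⁺ |𝒟_q f(x) / f(x)|` is at most `log 2` plus the two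
differences `|log|f(x̂)| - log|f(x)||` and `|log|f(x̌)| - log|f(x)||`. Choosing `|z| ≥ 1` gives `x̂
= p x + O(1/r)` and `x̌ = p⁻¹ x + O(1/r)`, so all three points lie in a disc of radius `O(r)`.

Subtracting the Poisson-Jensen formula on `|z| < R` at two such points (`abs_log_norm_sub_le`)
leaves three terms: the kernels differ by `O(r/R)`, which costs `(r/R)(T(R) + 1)`; every zero or
pole costs `O(1)`; and those of modulus `O(r)` cost in addition `log (O(r) / |y - u|)`, where `y` is
one of the points. Since `|y|` is `κ r` up to `O(1/r)`, with `κ` one of `1, |p|, |p⁻¹|`, the last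
terms are governed by `|r - |u|/κ|`, a function of the radius alone. A Markov argument on dyadic
intervals (`exists_exceptional_set`) bounds their sum by `O((1 + log log r) n)` off a set of finite
logarithmic measure, `n` being a number of zeros and poles in a disc of radius `O(r)`.

The outcome, `exists_posLog_awOperator_div_le`, is the bound `O(1 + (r/R)(T(R) + 1) + (1 + log log
r) n(R))`, valid for all `R ≥ K r`. It remains to insert `n(R) log(S/R) ≤ 2 T(S) + O(1)`, `T ≤ φ^(ρ
+ ε/4)` and `log log r ≤ log φ(r)`. In case (a), `R` is the geometric mean of `r` and `S = s(r)`, so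
both main terms gain a factor `1 / log(s(r)/r)`. In case (b), `R = K r` and `S = 2 K r`, and
subadditivity compares `φ(S)` with `φ(r)`. The second estimate in (a) follows from `log(s(r)/r) ≥
φ(r)^(γ - δ) ≥ φ(s(r))^((α - δ)(γ - δ))` when `γ > 0`, and from `liminf s(r)/r > 1` when `γ = 0`. -/

/-! ### Regular points and the Poisson-Jensen formula -/

/-- A point at which `f` is analytic and does not vanish. -/
def RegularPt (f : ℂ → ℂ) (x : ℂ) : Prop := AnalyticAt ℂ f x ∧ f x ≠ 0

theorem RegularPt.order_eq_zero {f : ℂ → ℂ} {x : ℂ} (h : RegularPt f x) :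
    meromorphicOrderAt f x = 0 :=
  (h.1.meromorphicNFAt).meromorphicOrderAt_eq_zero_iff.2 h.2

theorem RegularPt.trailingCoeff {f : ℂ → ℂ} {x : ℂ} (h : RegularPt f x) :
    meromorphicTrailingCoeffAt f x = f x :=
  h.1.meromorphicTrailingCoeffAt_of_ne_zero h.2

theorem regularPt_codiscrete {f : ℂ → ℂ} (hf : Meromorphic f)
    (hne : ∀ z, meromorphicOrderAt f z ≠ ⊤) : {x | RegularPt f x} ∈ codiscrete ℂ := by
  rw [mem_codiscrete]
  intro x
  rw [disjoint_principal_right, compl_compl]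
  have h1 := (hf x).eventually_analyticAt
  have h2 := (meromorphicOrderAt_ne_top_iff_eventually_ne_zero (hf x)).1 (hne x)
  filter_upwards [h1, h2] with y a b using ⟨a, b⟩

/-- The canonical decomposition splits `f` into a zero-free analytic `h`, canonical factors for the
interior divisor, and linear factors for the divisor on the circle. The kernel average reproduces
`log|h|` by harmonicity, still reproduces `log|z - i|` for `i` on the circle, and does not see the
canonical factors, which have modulus one there. The sum is subtracted because a canonical factor
has a pole at its index. -/
theorem poissonJensen {f : ℂ → ℂ} (hf : Meromorphic f)
    (hne : ∀ z, meromorphicOrderAt f z ≠ ⊤) {R : ℝ} {w : ℂ} (hw : w ∈ Metric.ball 0 R)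
    (hreg : RegularPt f w) :
    Real.log ‖f w‖ =
      Real.circleAverage ((Complex.re ∘ herglotzRieszKernel 0 w) * fun z => Real.log ‖f z‖) 0 R
      - ∑ᶠ i, (MeromorphicOn.divisor f (Metric.ball 0 R) i : ℝ)
          * Real.log ‖Complex.canonicalFactor R i w‖ := by
  have hR : 0 < R := Metric.pos_of_mem_ball hw
  obtain ⟨h, D⟩ := (hf.meromorphicOn (s := Metric.closedBall 0 R)).exists_ecanonicalDecomp
    (fun u => hne u)
  set Ds := MeromorphicOn.divisor f (Metric.sphere 0 R) with hDs
  have hfin : Ds.support.Finite := Ds.finiteSupport (isCompact_sphere 0 R)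
  set t := hfin.toFinset with ht
  have hsph : ∀ z : ℂ, ∑ᶠ i, (Ds i : ℝ) * Real.log ‖z - i‖
      = ∑ i ∈ t, (Ds i : ℝ) * Real.log ‖z - i‖ := by
    intro z
    apply finsum_eq_sum_of_support_subset
    intro i hi
    simp only [ht, Finite.coe_toFinset, Function.mem_support] at hi ⊢
    intro h0
    apply hi
    simp [h0]
  have hmem : ∀ i ∈ t, i ∈ Metric.sphere (0 : ℂ) R := by
    intro i hi
    exact Ds.supportWithinDomain (by simpa [ht] using hi)
  have hKc : ContinuousOn (Complex.re ∘ herglotzRieszKernel 0 w) (Metric.sphere 0 |R|) :=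
    Complex.continuous_re.comp_continuousOn (continuousOn_herglotzRieszKernel_sphere hw)
  have hlogf : (fun z => Real.log ‖f z‖) =ᶠ[codiscreteWithin (Metric.sphere 0 |R|)]
      ((fun z => Real.log ‖h z‖) + ∑ i ∈ t, (Ds i : ℝ) • fun z => Real.log ‖z - i‖) := by
    have h1 : {x | RegularPt f x} ∈ codiscreteWithin (Metric.sphere (0 : ℂ) |R|) :=
      codiscreteWithin_mono (subset_univ _) (regularPt_codiscrete hf hne)
    filter_upwards [h1, self_mem_codiscreteWithin (Metric.sphere (0 : ℂ) |R|)] with z hz hzs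
    rw [abs_of_pos hR] at hzs
    have e := D.log_norm_eq (Metric.sphere_subset_closedBall hzs) hz.order_eq_zero hR
    rw [hz.trailingCoeff, ← hDs, hsph] at e
    have e0 : ∑ᶠ (i : ℂ), ((MeromorphicOn.divisor f (Metric.ball 0 R)) i : ℝ)
        * Real.log ‖Complex.canonicalFactor R i z‖ = 0 := by
      refine finsum_eq_zero_of_forall_eq_zero fun i => ?_
      by_cases hi : i ∈ Metric.ball (0 : ℂ) R
      · rw [Complex.norm_canonicalFactor_eval_circle_eq_one hi hzs]
        simp
      · simp [hi]
    rw [e0] at e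
    simp only [Pi.add_apply, Finset.sum_apply, Pi.smul_apply, smul_eq_mul]
    linarith
  have hharm : InnerProductSpace.HarmonicOnNhd (fun z => Real.log ‖h z‖)
      (Metric.closedBall 0 R) := fun z hz =>
    (D.analyticOnNhd z hz).harmonicAt_log_norm (D.ne_zero z hz)
  have hhar := hharm.circleAverage_re_herglotzRieszKernel_smul hw
  have hI0 : CircleIntegrable (fun z => Real.log ‖h z‖) 0 R := by
    apply MeromorphicOn.circleIntegrable_log_norm
    intro z hz
    rw [abs_of_pos hR] at hz
    exact (D.analyticOnNhd z (Metric.sphere_subset_closedBall hz)).meromorphicAt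
  have hIi : ∀ i, CircleIntegrable (fun z => Real.log ‖z - i‖) 0 R := by
    intro i
    apply MeromorphicOn.circleIntegrable_log_norm
    intro z hz
    fun_prop
  have key : Real.circleAverage ((Complex.re ∘ herglotzRieszKernel 0 w) *
      fun z => Real.log ‖f z‖) 0 R = Real.log ‖h w‖ + ∑ i ∈ t, (Ds i : ℝ) * Real.log ‖w - i‖ := by
    rw [Real.circleAverage_congr_codiscreteWithin (f₂ :=
      ((Complex.re ∘ herglotzRieszKernel 0 w) * fun z => Real.log ‖h z‖) +
      ∑ i ∈ t, (Ds i : ℝ) • ((Complex.re ∘ herglotzRieszKernel 0 w) *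
        fun z => Real.log ‖z - i‖)) _ hR.ne']
    · rw [Real.circleAverage_add, Real.circleAverage_sum]
      · congr 1
        apply Finset.sum_congr rfl
        intro i hi
        rw [Real.circleAverage_smul, circleAverage_re_herglotzRieszKernel_mul_log (hmem i hi) hw,
          smul_eq_mul]
      · intro i _
        exact ((hIi i).continuousOn_mul hKc).const_smul
      · exact hI0.continuousOn_mul hKc
      · apply CircleIntegrable.sum
        intro i _
        exact ((hIi i).continuousOn_mul hKc).const_smul
    · filter_upwards [hlogf] with z hz
      simp only [Pi.mul_apply, Pi.add_apply, Finset.sum_apply, Pi.smul_apply, smul_eq_mul] at hz ⊢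
      rw [hz, mul_add, Finset.mul_sum]
      congr 1
      apply Finset.sum_congr rfl
      intro i _
      ring
  have e := D.log_norm_eq (Metric.ball_subset_closedBall hw) hreg.order_eq_zero hR
  rw [hreg.trailingCoeff, ← hDs, hsph] at e
  rw [key]
  linarith

/-! ### Counting zeros and poles -/

/-- The absolute value of the multiplicity of the zero or pole of `f` at `u`. -/
noncomputable def divW (f : ℂ → ℂ) (u : ℂ) : ℝ := |((MeromorphicOn.divisor f univ u : ℤ) : ℝ)|

/-- The zeros and poles of `f` in the closed disc of radius `r`. -/
noncomputable def zpFinset (f : ℂ → ℂ) (r : ℝ) : Finset ℂ :=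
  ((MeromorphicOn.divisor f (Metric.closedBall 0 r)).finiteSupport
    (isCompact_closedBall 0 r)).toFinset

/-- The number of zeros and poles of `f` in the closed disc of radius `r`. -/
noncomputable def zpCount (f : ℂ → ℂ) (r : ℝ) : ℝ := ∑ u ∈ zpFinset f r, divW f u

theorem divW_nonneg (f : ℂ → ℂ) (u : ℂ) : 0 ≤ divW f u := abs_nonneg _

theorem mem_zpFinset {f : ℂ → ℂ} (hf : Meromorphic f) {r : ℝ} {u : ℂ} :
    u ∈ zpFinset f r ↔ ‖u‖ ≤ r ∧ divW f u ≠ 0 := by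
  by_cases hu : u ∈ Metric.closedBall (0 : ℂ) r
  · have hu' : ‖u‖ ≤ r := by simpa using hu
    simp [zpFinset, divW, MeromorphicOn.divisor_apply hf.meromorphicOn hu,
      MeromorphicOn.divisor_apply hf.meromorphicOn (mem_univ u), hu']
  · have hu' : ¬ ‖u‖ ≤ r := by simpa using hu
    simp only [zpFinset, Finite.mem_toFinset, Function.mem_support, ne_eq, hu', false_and,
      iff_false, not_not]
    exact Function.locallyFinsuppWithin.apply_eq_zero_of_notMem _ hu

theorem zpFinset_mono {f : ℂ → ℂ} (hf : Meromorphic f) {r t : ℝ} (h : r ≤ t) :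
    zpFinset f r ⊆ zpFinset f t := by
  intro u
  rw [mem_zpFinset hf, mem_zpFinset hf]
  exact fun ⟨a, b⟩ => ⟨a.trans h, b⟩

theorem zpCount_mono {f : ℂ → ℂ} (hf : Meromorphic f) {r t : ℝ} (h : r ≤ t) :
    zpCount f r ≤ zpCount f t :=
  Finset.sum_le_sum_of_subset_of_nonneg (zpFinset_mono hf h) fun _ _ _ => divW_nonneg _ _

theorem zpCount_nonneg (f : ℂ → ℂ) (r : ℝ) : 0 ≤ zpCount f r :=
  Finset.sum_nonneg fun _ _ => divW_nonneg _ _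

theorem one_le_divW {f : ℂ → ℂ} {u : ℂ} (h : divW f u ≠ 0) : 1 ≤ divW f u := by
  unfold divW at *
  rw [← Int.cast_abs] at *
  have : (0 : ℤ) < |MeromorphicOn.divisor f univ u| := by
    rcases (abs_nonneg (MeromorphicOn.divisor f univ u)).lt_or_eq with h' | h'
    · exact h'
    · rw [← h'] at h; simp at h
  exact_mod_cast this

/-- Each zero or pole of modulus at most `R` contributes at least `log (S / R)` per multiplicity to
`N(S, 0) + N(S, ∞)`, which is at most `T(S, 1/f) + T(S, f)`. Jensen's formula bounds this by `2 T(S,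
f)` up to a constant. -/
theorem zpCount_mul_log_le {f : ℂ → ℂ} (hf : Meromorphic f) :
    ∃ C : ℝ, ∀ R S : ℝ, 1 ≤ R → R ≤ S →
      zpCount f R * Real.log (S / R) ≤ 2 * ValueDistribution.characteristic f ⊤ S + C := by
  refine ⟨max |Real.log ‖f 0‖| |Real.log ‖meromorphicTrailingCoeffAt f 0‖|, fun R S hR hS => ?_⟩
  have hS0 : 0 < S := by linarith
  have hT := ValueDistribution.characteristic_sub_characteristic_inv_le hf (R := S)
  have hT' := neg_abs_le (ValueDistribution.characteristic f ⊤ S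
    - ValueDistribution.characteristic f⁻¹ ⊤ S)
  have h1 : ValueDistribution.logCounting f 0 S ≤ ValueDistribution.characteristic f⁻¹ ⊤ S := by
    rw [← ValueDistribution.logCounting_inv]
    simp only [ValueDistribution.characteristic, Pi.add_apply]
    have h0 : (0 : ℝ) ≤ ValueDistribution.proximity (f⁻¹) ⊤ S :=
      ValueDistribution.proximity_nonneg S
    linarith
  have h2 : ValueDistribution.logCounting f ⊤ S ≤ ValueDistribution.characteristic f ⊤ S := by
    simp only [ValueDistribution.characteristic, Pi.add_apply]
    have h0 : (0 : ℝ) ≤ ValueDistribution.proximity (f) ⊤ S :=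
      ValueDistribution.proximity_nonneg S
    linarith
  suffices h : zpCount f R * Real.log (S / R) ≤ ValueDistribution.logCounting f 0 S
      + ValueDistribution.logCounting f ⊤ S by linarith
  set D := MeromorphicOn.divisor f univ with hD
  set E := D⁺ + D⁻ with hE
  have hEu : ∀ u, ((E u : ℤ) : ℝ) = divW f u := by
    intro u
    rw [divW, ← Int.cast_abs, hE]
    congr 1
    exact posPart_add_negPart (D u)
  have e : ValueDistribution.logCounting f 0 S + ValueDistribution.logCounting f ⊤ S
      = Function.locallyFinsuppWithin.logCounting E S := by
    rw [ValueDistribution.logCounting_zero, ValueDistribution.logCounting_top, hE, map_add,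
      Pi.add_apply]
  rw [e]
  have hval : Function.locallyFinsuppWithin.logCounting E S =
      ∑ u ∈ zpFinset f S, divW f u * Real.log (S * ‖u‖⁻¹) + divW f 0 * Real.log S := by
    simp only [Function.locallyFinsuppWithin.logCounting, AddMonoidHom.coe_mk, ZeroHom.coe_mk, hEu]
    congr 1
    rw [finsum_eq_sum_of_support_subset (s := zpFinset f S)]
    · apply Finset.sum_congr rfl
      intro u hu
      rw [Function.locallyFinsuppWithin.toClosedBall_eval_within, hEu]
      simpa [abs_of_pos hS0] using ((mem_zpFinset hf).1 hu).1
    · intro u hu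
      have hm : u ∈ Metric.closedBall (0 : ℂ) |S| := by
        by_contra hm
        apply hu
        simp [Function.locallyFinsuppWithin.apply_eq_zero_of_notMem _ hm]
      rw [Finset.mem_coe, mem_zpFinset hf]
      refine ⟨by simpa [abs_of_pos hS0] using hm, fun h0 => hu ?_⟩
      simp only [Function.locallyFinsuppWithin.toClosedBall_eval_within _ hm, hEu, h0, zero_mul]
  rw [hval, zpCount, Finset.sum_mul]
  have hlog : 0 ≤ Real.log (S / R) := Real.log_nonneg (by rw [le_div_iff₀ (by linarith)]; linarith)
  have hlogS : Real.log (S / R) ≤ Real.log S :=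
    Real.log_le_log (by positivity) (div_le_self hS0.le hR)
  -- The origin needs its own term: `Real.log (S * ‖0‖⁻¹)` is `0` by convention, and its true weight
  -- `log S` is the separate summand of the counting function.
  have hsub : ∑ u ∈ zpFinset f R, (divW f u * Real.log (S * ‖u‖⁻¹)
      + if u = 0 then divW f u * Real.log S else 0) ≤
      ∑ u ∈ zpFinset f S, divW f u * Real.log (S * ‖u‖⁻¹) + divW f 0 * Real.log S := by
    rw [Finset.sum_add_distrib]
    apply add_le_add
    · apply Finset.sum_le_sum_of_subset_of_nonneg (zpFinset_mono hf hS)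
      intro u hu _
      apply mul_nonneg (divW_nonneg _ _)
      by_cases h0 : u = 0
      · simp [h0]
      · apply Real.log_nonneg
        rw [← div_eq_mul_inv, le_div_iff₀ (norm_pos_iff.2 h0), one_mul]
        exact ((mem_zpFinset hf).1 hu).1
    · rw [Finset.sum_ite_eq']
      split_ifs
      · exact le_rfl
      · exact mul_nonneg (divW_nonneg _ _) (Real.log_nonneg (by linarith))
  refine le_trans (Finset.sum_le_sum fun u hu => ?_) hsub
  by_cases h0 : u = 0
  · simp only [h0, norm_zero, inv_zero, mul_zero, Real.log_zero, if_true, zero_add]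
    exact mul_le_mul_of_nonneg_left hlogS (divW_nonneg _ _)
  · simp only [h0, if_false, add_zero]
    apply mul_le_mul_of_nonneg_left _ (divW_nonneg _ _)
    apply Real.log_le_log (by positivity)
    rw [← div_eq_mul_inv]
    exact div_le_div_of_nonneg_left hS0.le (norm_pos_iff.2 h0) ((mem_zpFinset hf).1 hu).1

/-! ### Comparing `log|f|` at two points -/

theorem abs_log_sub_log_le {m a b : ℝ} (hm : 0 < m) (ha : m ≤ a) (ha' : a ≤ 3 * m) (hb : m ≤ b)
    (hb' : b ≤ 3 * m) : |Real.log a - Real.log b| ≤ 2 := by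
  have h3 : Real.log (3 * m) ≤ 2 + Real.log m := by
    rw [Real.log_mul (by norm_num) hm.ne']
    have := Real.log_le_sub_one_of_pos (show (0 : ℝ) < 3 by norm_num)
    linarith
  have := Real.log_le_log hm ha
  have := Real.log_le_log hm hb
  have := Real.log_le_log (hm.trans_le ha) ha'
  have := Real.log_le_log (hm.trans_le hb) hb'
  rw [abs_le]
  constructor <;> linarith

/-- The factor is `(R² - ū w) / (R (w - u))`. Its numerator stays within a factor 3 over `|w| ≤ ρ`,
as does `|w - u|` when `|u| > 2ρ`; each costs at most `log 3 ≤ 2`. Only a near `u` leaves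
logarithmic singularities. -/
theorem abs_log_canonicalFactor_sub_le {R ρ : ℝ} {u x y : ℂ} (hρ : 0 < ρ) (hR : 2 * ρ ≤ R)
    (hu : ‖u‖ ≤ R) (hx : ‖x‖ ≤ ρ) (hy : ‖y‖ ≤ ρ) (hxu : x ≠ u) (hyu : y ≠ u) :
    |Real.log ‖Complex.canonicalFactor R u x‖ - Real.log ‖Complex.canonicalFactor R u y‖| ≤
      4 + if ‖u‖ ≤ 2 * ρ then Real.log (3 * ρ / ‖x - u‖) + Real.log (3 * ρ / ‖y - u‖) else 0 := by
  have hR0 : 0 < R := by linarith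
  have hnum : ∀ w : ℂ, ‖w‖ ≤ ρ → R ^ 2 / 2 ≤ ‖(R : ℂ) ^ 2 - (starRingEnd ℂ) u * w‖ ∧
      ‖(R : ℂ) ^ 2 - (starRingEnd ℂ) u * w‖ ≤ 3 * (R ^ 2 / 2) := by
    intro w hw
    have h1 : ‖(starRingEnd ℂ) u * w‖ ≤ R ^ 2 / 2 := by
      rw [norm_mul, RCLike.norm_conj]
      nlinarith [norm_nonneg u, norm_nonneg w, mul_le_mul hu hw (norm_nonneg w) hR0.le]
    have h2 : ‖(R : ℂ) ^ 2‖ = R ^ 2 := by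
      rw [norm_pow, Complex.norm_real, Real.norm_eq_abs, sq_abs]
    constructor
    · have := norm_sub_norm_le ((R : ℂ) ^ 2) ((starRingEnd ℂ) u * w)
      linarith
    · have := norm_sub_le ((R : ℂ) ^ 2) ((starRingEnd ℂ) u * w)
      linarith
  have hR2 : 0 < R ^ 2 / 2 := by positivity
  have hval : ∀ w : ℂ, ‖w‖ ≤ ρ → w ≠ u → Real.log ‖Complex.canonicalFactor R u w‖ =
      Real.log ‖(R : ℂ) ^ 2 - (starRingEnd ℂ) u * w‖ - (Real.log R + Real.log ‖w - u‖) := by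
    intro w hw hwu
    have h1 := (hnum w hw).1
    rw [Complex.canonicalFactor_apply, norm_div, norm_mul, Complex.norm_real, Real.norm_eq_abs,
      abs_of_pos hR0, Real.log_div (by linarith) (by
        have := norm_pos_iff.2 (sub_ne_zero.2 hwu); positivity),
      Real.log_mul hR0.ne' (norm_pos_iff.2 (sub_ne_zero.2 hwu)).ne']
  rw [hval x hx hxu, hval y hy hyu]
  have hA := abs_log_sub_log_le hR2 (hnum x hx).1 (hnum x hx).2 (hnum y hy).1 (hnum y hy).2
  have hxp := norm_pos_iff.2 (sub_ne_zero.2 hxu)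
  have hyp := norm_pos_iff.2 (sub_ne_zero.2 hyu)
  have hB : |Real.log ‖x - u‖ - Real.log ‖y - u‖| ≤ 2 + if ‖u‖ ≤ 2 * ρ then
      Real.log (3 * ρ / ‖x - u‖) + Real.log (3 * ρ / ‖y - u‖) else 0 := by
    split_ifs with h
    · have h1 : ‖x - u‖ ≤ 3 * ρ := (norm_sub_le _ _).trans (by linarith)
      have h2 : ‖y - u‖ ≤ 3 * ρ := (norm_sub_le _ _).trans (by linarith)
      rw [Real.log_div (by positivity) hxp.ne', Real.log_div (by positivity) hyp.ne', abs_le]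
      have := Real.log_le_log hxp h1
      have := Real.log_le_log hyp h2
      constructor <;> linarith
    · push Not at h
      have hb : ∀ w : ℂ, ‖w‖ ≤ ρ → ‖u‖ / 2 ≤ ‖w - u‖ ∧ ‖w - u‖ ≤ 3 * (‖u‖ / 2) := by
        intro w hw
        constructor
        · have := norm_sub_norm_le u w
          rw [norm_sub_rev] at this
          linarith
        · have := norm_sub_le w u
          linarith
      rw [add_zero]
      exact abs_log_sub_log_le (by linarith) (hb x hx).1 (hb x hx).2 (hb y hy).1 (hb y hy).2
  rw [abs_le] at hA hB ⊢
  constructor <;> linarith [hA.1, hA.2, hB.1, hB.2]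

/-- Harnack's bounds `(R - |w|)/(R + |w|)` and `(R + |w|)/(R - |w|)` are both `1 + O(ρ/R)`. This
closeness to `1` produces the factor `r/R` in front of the characteristic. -/
theorem abs_re_herglotzRieszKernel_sub_one_le {R ρ : ℝ} {w z : ℂ} (hρ : 0 < ρ) (hR : 2 * ρ ≤ R)
    (hw : ‖w‖ ≤ ρ) (hz : z ∈ Metric.sphere 0 R) :
    |(herglotzRieszKernel 0 w z).re - 1| ≤ 4 * ρ / R := by
  have hR0 : 0 < R := by linarith
  have hwb : w ∈ Metric.ball (0 : ℂ) R := by simpa using by linarith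
  have h1 := re_herglotzRieszKernel_le hz hwb
  have h2 := le_re_herglotzRieszKernel hz hwb
  rw [← herglotzRieszKernel_def] at h1 h2
  rw [sub_zero] at h1 h2
  have h3 : (R + ‖w‖) / (R - ‖w‖) ≤ 1 + 4 * ρ / R := by
    rw [div_le_iff₀ (by linarith), ← sub_nonneg]
    have : (1 + 4 * ρ / R) * (R - ‖w‖) - (R + ‖w‖)
      = (4 * ρ * (R - ‖w‖) - 2 * ‖w‖ * R) / R := by field_simp; ring
    rw [this]
    apply div_nonneg _ hR0.le
    nlinarith [norm_nonneg w]
  have h4 : 1 - 4 * ρ / R ≤ (R - ‖w‖) / (R + ‖w‖) := by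
    have hw0 := norm_nonneg w
    rw [le_div_iff₀ (by linarith), ← sub_nonneg]
    have : (R - ‖w‖) - (1 - 4 * ρ / R) * (R + ‖w‖)
      = (4 * ρ * (R + ‖w‖) - 2 * ‖w‖ * R) / R := by field_simp; ring
    rw [this]
    apply div_nonneg _ hR0.le
    nlinarith [norm_nonneg w]
  rw [abs_le]
  constructor <;> linarith

theorem abs_log_eq_posLog (x : ℝ) : |Real.log x| = Real.posLog x + Real.posLog x⁻¹ := by
  simp only [Real.posLog, Real.log_inv]
  rcases le_total 0 (Real.log x) with h | h
  · rw [abs_of_nonneg h, max_eq_right h, max_eq_left (by linarith)]; ring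
  · rw [abs_of_nonpos h, max_eq_left h, max_eq_right (by linarith)]; ring

theorem proximity_add_proximity_le {f : ℂ → ℂ} (hf : Meromorphic f) :
    ∃ C : ℝ, ∀ R : ℝ, 1 ≤ R → Real.circleAverage |fun z => Real.log ‖f z‖| 0 R
      ≤ 2 * ValueDistribution.characteristic f ⊤ R + C := by
  refine ⟨max |Real.log ‖f 0‖| |Real.log ‖meromorphicTrailingCoeffAt f 0‖|, fun R hR => ?_⟩
  have hT := ValueDistribution.characteristic_sub_characteristic_inv_le hf (R := R)
  have hT' := neg_abs_le (ValueDistribution.characteristic f ⊤ R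
    - ValueDistribution.characteristic f⁻¹ ⊤ R)
  have h1 : ValueDistribution.proximity f⁻¹ ⊤ R ≤ ValueDistribution.characteristic f⁻¹ ⊤ R := by
    simp only [ValueDistribution.characteristic, Pi.add_apply]
    linarith [ValueDistribution.logCounting_nonneg hR (f := f⁻¹) (e := ⊤)]
  have h2 : ValueDistribution.proximity f ⊤ R ≤ ValueDistribution.characteristic f ⊤ R := by
    simp only [ValueDistribution.characteristic, Pi.add_apply]
    linarith [ValueDistribution.logCounting_nonneg hR (f := f) (e := ⊤)]
  have e : Real.circleAverage |fun z => Real.log ‖f z‖| 0 R =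
      ValueDistribution.proximity f ⊤ R + ValueDistribution.proximity f⁻¹ ⊤ R := by
    rw [ValueDistribution.proximity_top, ValueDistribution.proximity_top,
      ← Real.circleAverage_fun_add]
    · congr 1
      ext z
      simp only [Pi.abs_apply, Pi.inv_apply, norm_inv]
      exact abs_log_eq_posLog _
    · exact hf.meromorphicOn.circleIntegrable_posLog_norm
    · exact hf.inv.meromorphicOn.circleIntegrable_posLog_norm
  linarith

theorem abs_log_norm_sub_le {f : ℂ → ℂ} (hf : Meromorphic f)
    (hne : ∀ z, meromorphicOrderAt f z ≠ ⊤) {R ρ : ℝ} {x y : ℂ} (hρ : 0 < ρ) (hR : 2 * ρ ≤ R)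
    (hx : ‖x‖ ≤ ρ) (hy : ‖y‖ ≤ ρ) (hxr : RegularPt f x) (hyr : RegularPt f y) :
    |Real.log ‖f x‖ - Real.log ‖f y‖| ≤
      8 * ρ / R * Real.circleAverage |fun z => Real.log ‖f z‖| 0 R + 4 * zpCount f R
      + ∑ u ∈ zpFinset f (2 * ρ), divW f u * (Real.log (3 * ρ / ‖x - u‖)
          + Real.log (3 * ρ / ‖y - u‖)) := by
  have hR0 : 0 < R := by linarith
  have hxb : x ∈ Metric.ball (0 : ℂ) R := by simpa using by linarith
  have hyb : y ∈ Metric.ball (0 : ℂ) R := by simpa using by linarith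
  have hI : CircleIntegrable (fun z => Real.log ‖f z‖) 0 R :=
    hf.meromorphicOn.circleIntegrable_log_norm
  have hKc : ∀ w ∈ Metric.ball (0 : ℂ) R,
      ContinuousOn (Complex.re ∘ herglotzRieszKernel 0 w) (Metric.sphere 0 |R|) := fun w hw =>
    Complex.continuous_re.comp_continuousOn (continuousOn_herglotzRieszKernel_sphere hw)
  have hsum : ∀ w : ℂ, ∑ᶠ i, (MeromorphicOn.divisor f (Metric.ball 0 R) i : ℝ)
      * Real.log ‖Complex.canonicalFactor R i w‖ = ∑ i ∈ zpFinset f R,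
        (MeromorphicOn.divisor f (Metric.ball 0 R) i : ℝ)
          * Real.log ‖Complex.canonicalFactor R i w‖ := by
    intro w
    apply finsum_eq_sum_of_support_subset
    intro i hi
    have hib : i ∈ Metric.ball (0 : ℂ) R := by
      by_contra hib
      apply hi
      simp [hib]
    rw [Finset.mem_coe, mem_zpFinset hf]
    have hi' : ‖i‖ < R := by simpa using hib
    refine ⟨hi'.le, fun h0 => hi ?_⟩
    have : MeromorphicOn.divisor f (Metric.ball 0 R) i = MeromorphicOn.divisor f univ i := by
      rw [MeromorphicOn.divisor_apply hf.meromorphicOn hib,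
        MeromorphicOn.divisor_apply hf.meromorphicOn (mem_univ i)]
    rw [divW, abs_eq_zero, ← this] at h0
    simp [h0]
  have hkern : |Real.circleAverage ((Complex.re ∘ herglotzRieszKernel 0 x) *
        fun z => Real.log ‖f z‖) 0 R - Real.circleAverage ((Complex.re ∘ herglotzRieszKernel 0 y) *
        fun z => Real.log ‖f z‖) 0 R| ≤
      8 * ρ / R * Real.circleAverage |fun z => Real.log ‖f z‖| 0 R := by
    rw [← Real.circleAverage_sub (hI.continuousOn_mul (hKc x hxb))
      (hI.continuousOn_mul (hKc y hyb)), ← smul_eq_mul (8 * ρ / R),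
      ← Real.circleAverage_smul]
    refine Real.abs_circleAverage_le_circleAverage_abs.trans (Real.circleAverage_mono ?_ ?_ ?_)
    · exact ((hI.continuousOn_mul (hKc x hxb)).sub (hI.continuousOn_mul (hKc y hyb))).abs
    · exact hI.abs.const_smul
    · intro z hz
      rw [abs_of_pos hR0] at hz
      have h1 := abs_re_herglotzRieszKernel_sub_one_le hρ hR hx hz
      have h2 := abs_re_herglotzRieszKernel_sub_one_le hρ hR hy hz
      simp only [Pi.abs_apply, Pi.sub_apply, Pi.mul_apply, Function.comp_apply, Pi.smul_apply,
        smul_eq_mul]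
      rw [← sub_mul, abs_mul]
      apply mul_le_mul_of_nonneg_right _ (abs_nonneg _)
      rw [abs_le] at *
      have : 8 * ρ / R = 4 * ρ / R + 4 * ρ / R := by ring
      constructor <;> linarith [h1.1, h1.2, h2.1, h2.2]
  have hne' : ∀ w : ℂ, RegularPt f w → ∀ u ∈ zpFinset f R, w ≠ u := by
    rintro w hw u hu rfl
    apply ((mem_zpFinset hf).1 hu).2
    simp [divW, MeromorphicOn.divisor_apply hf.meromorphicOn (mem_univ w), hw.order_eq_zero]
  have hfac : |∑ᶠ i, (MeromorphicOn.divisor f (Metric.ball 0 R) i : ℝ)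
      * Real.log ‖Complex.canonicalFactor R i x‖ -
      ∑ᶠ i, (MeromorphicOn.divisor f (Metric.ball 0 R) i : ℝ)
      * Real.log ‖Complex.canonicalFactor R i y‖| ≤ 4 * zpCount f R
      + ∑ u ∈ zpFinset f (2 * ρ), divW f u * (Real.log (3 * ρ / ‖x - u‖)
          + Real.log (3 * ρ / ‖y - u‖)) := by
    rw [hsum, hsum, ← Finset.sum_sub_distrib]
    refine (Finset.abs_sum_le_sum_abs _ _).trans ?_
    have hstep : ∀ u ∈ zpFinset f R, |(MeromorphicOn.divisor f (Metric.ball 0 R) u : ℝ)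
        * Real.log ‖Complex.canonicalFactor R u x‖ -
        (MeromorphicOn.divisor f (Metric.ball 0 R) u : ℝ)
        * Real.log ‖Complex.canonicalFactor R u y‖| ≤ 4 * divW f u +
          if ‖u‖ ≤ 2 * ρ then divW f u * (Real.log (3 * ρ / ‖x - u‖)
          + Real.log (3 * ρ / ‖y - u‖)) else 0 := by
      intro u hu
      have h1 := abs_log_canonicalFactor_sub_le hρ hR ((mem_zpFinset hf).1 hu).1 hx hy
        (hne' x hxr u hu) (hne' y hyr u hu)
      rw [← mul_sub, abs_mul]
      have h2 : |(MeromorphicOn.divisor f (Metric.ball 0 R) u : ℝ)| ≤ divW f u := by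
        by_cases hub : u ∈ Metric.ball (0 : ℂ) R
        · rw [divW, MeromorphicOn.divisor_apply hf.meromorphicOn hub,
            MeromorphicOn.divisor_apply hf.meromorphicOn (mem_univ u)]
        · simp only [hub, not_false_eq_true,
            Function.locallyFinsuppWithin.apply_eq_zero_of_notMem, Int.cast_zero, abs_zero]
          exact divW_nonneg _ _
      refine (mul_le_mul h2 h1 (abs_nonneg _) (divW_nonneg _ _)).trans (le_of_eq ?_)
      split_ifs <;> ring
    refine (Finset.sum_le_sum hstep).trans (le_of_eq ?_)
    rw [Finset.sum_add_distrib, ← Finset.mul_sum, zpCount, ← Finset.sum_filter]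
    congr 2
    ext u
    simp only [Finset.mem_filter, mem_zpFinset hf]
    constructor
    · rintro ⟨⟨_, h⟩, h'⟩; exact ⟨h', h⟩
    · rintro ⟨h', h⟩; exact ⟨⟨h'.trans hR, h⟩, h'⟩
  rw [poissonJensen hf hne hxb hxr, poissonJensen hf hne hyb hyr]
  rw [abs_le] at *
  constructor <;> linarith [hkern.1, hkern.2, hfac.1, hfac.2]

/-! ### The exceptional set of radii -/

theorem lintegral_sqrt_div_le {a : ℝ} (ha : 0 < a) :
    ∫⁻ t, (Ioc 0 a).indicator (fun t => ENNReal.ofReal √(a / t)) t ≤ ENNReal.ofReal (2 * a) := by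
  rw [lintegral_indicator measurableSet_Ioc]
  have hint : IntervalIntegrable (fun t : ℝ => √a * t ^ (-(1 / 2) : ℝ)) volume 0 a :=
    (intervalIntegral.intervalIntegrable_rpow' (by norm_num)).const_mul _
  have hI : IntegrableOn (fun t : ℝ => √a * t ^ (-(1 / 2) : ℝ)) (Ioc 0 a) :=
    (intervalIntegrable_iff_integrableOn_Ioc_of_le ha.le).1 hint
  have e : ∫⁻ t in Ioc 0 a, ENNReal.ofReal √(a / t)
      = ∫⁻ t in Ioc 0 a, ENNReal.ofReal (√a * t ^ (-(1 / 2) : ℝ)) := by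
    apply setLIntegral_congr_fun measurableSet_Ioc
    intro t ht
    simp only
    rw [Real.sqrt_div ha.le, Real.sqrt_eq_rpow t, Real.rpow_neg ht.1.le, div_eq_mul_inv]
  rw [e, ← ofReal_integral_eq_lintegral_ofReal hI]
  · apply ENNReal.ofReal_le_ofReal
    rw [← intervalIntegral.integral_of_le ha.le, intervalIntegral.integral_const_mul,
      integral_rpow (Or.inl (by norm_num))]
    have : (-(1 / 2) + 1 : ℝ) = 1 / 2 := by norm_num
    rw [this, Real.zero_rpow (by norm_num), ← Real.sqrt_eq_rpow]
    have := Real.mul_self_sqrt ha.le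
    linarith
  · filter_upwards [self_mem_ae_restrict measurableSet_Ioc] with t ht
    exact mul_nonneg (Real.sqrt_nonneg _) (Real.rpow_nonneg ht.1.le _)

/-- Each side of `τ` contributes at most `∫₀ᵃ √(a/t) dt = 2a`. Where `|t - τ| > a` the integrand is
at most `1`, adding at most `a`. The bound is uniform in `τ`. -/
theorem setLIntegral_sqrt_div_abs_sub_le {a : ℝ} (ha : 0 < a) (τ : ℝ) :
    ∫⁻ t in Icc a (2 * a), ENNReal.ofReal √(a / |t - τ|) ≤ ENNReal.ofReal (5 * a) := by
  set G : ℝ → ENNReal := (Ioc 0 a).indicator (fun t => ENNReal.ofReal √(a / t)) with hG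
  have hGm : Measurable G := by
    apply Measurable.indicator _ measurableSet_Ioc
    fun_prop
  have hpt : ∀ t, ENNReal.ofReal √(a / |t - τ|) ≤ (G (t - τ) + G (τ - t)) + 1 := by
    intro t
    rcases lt_or_ge a |t - τ| with h | h
    · refine le_trans ?_ le_add_self
      rw [← ENNReal.ofReal_one]
      apply ENNReal.ofReal_le_ofReal
      apply Real.sqrt_le_one.2
      rw [div_le_one (by linarith)]
      exact h.le
    · refine le_trans ?_ le_self_add
      rcases lt_trichotomy t τ with h' | h' | h'
      · refine le_trans ?_ le_add_self
        rw [abs_of_neg (by linarith), neg_sub] at h ⊢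
        rw [hG, indicator_of_mem (mem_Ioc.2 ⟨by linarith, h⟩)]
      -- At `t = τ` division by zero makes the integrand `0`.
      · simp [h']
      · refine le_trans ?_ le_self_add
        rw [abs_of_pos (by linarith)] at h ⊢
        rw [hG, indicator_of_mem (mem_Ioc.2 ⟨by linarith, h⟩)]
  calc ∫⁻ t in Icc a (2 * a), ENNReal.ofReal √(a / |t - τ|)
      ≤ ∫⁻ t in Icc a (2 * a), ((G (t - τ) + G (τ - t)) + 1) := lintegral_mono fun t => hpt t
    _ = (∫⁻ t in Icc a (2 * a), (G (t - τ) + G (τ - t))) + ∫⁻ t in Icc a (2 * a), 1 :=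
        lintegral_add_right _ measurable_const
    _ ≤ (∫⁻ t, (G (t - τ) + G (τ - t))) + ENNReal.ofReal a := by
        apply add_le_add (setLIntegral_le_lintegral _ _)
        rw [setLIntegral_one, Real.volume_Icc]
        apply ENNReal.ofReal_le_ofReal
        linarith
    _ ≤ (ENNReal.ofReal (2 * a) + ENNReal.ofReal (2 * a)) + ENNReal.ofReal a := by
        rw [lintegral_add_left (by fun_prop), lintegral_sub_right_eq_self G τ,
          lintegral_sub_left_eq_self G τ]
        gcongr <;> exact lintegral_sqrt_div_le ha
    _ = ENNReal.ofReal (5 * a) := by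
        rw [← ENNReal.ofReal_add (by positivity) (by positivity),
          ← ENNReal.ofReal_add (by positivity) (by positivity)]
        congr 1
        ring

/-- The sum `∑ w_u √(a / |t - τ_u|)`, which is large only near the points `τ_u`. -/
noncomputable def sqrtPotential {ι : Type*} (Z : Finset ι) (w τ : ι → ℝ) (a t : ℝ) : ℝ :=
  ∑ u ∈ Z, w u * √(a / |t - τ u|)

theorem measurable_sqrtPotential {ι : Type*} (Z : Finset ι) (w τ : ι → ℝ) (a : ℝ) :
    Measurable (sqrtPotential Z w τ a) := by
  unfold sqrtPotential
  apply Finset.measurable_fun_sum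
  intro u _
  have : Measurable fun t : ℝ => |t - τ u| := (by fun_prop : Continuous _).measurable
  fun_prop

/-- The radii in `[a, 2a]` at which `sqrtPotential` exceeds its natural size by a factor `M`. -/
def sqrtPotentialBad {ι : Type*} (Z : Finset ι) (w τ : ι → ℝ) (a M : ℝ) : Set ℝ :=
  Icc a (2 * a) ∩ {t | M * ∑ u ∈ Z, w u < sqrtPotential Z w τ a t}

theorem measurableSet_sqrtPotentialBad {ι : Type*} (Z : Finset ι) (w τ : ι → ℝ) (a M : ℝ) :
    MeasurableSet (sqrtPotentialBad Z w τ a M) :=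
  measurableSet_Icc.inter (measurableSet_lt measurable_const (measurable_sqrtPotential Z w τ a))

/-- Markov's inequality: the potential has integral at most `5 a` times the total weight, and `1/t ≤
1/a` on the interval. If the total weight is zero, the strict inequality makes the bad set empty. -/
theorem setLIntegral_sqrtPotentialBad_le {ι : Type*} (Z : Finset ι) {w τ : ι → ℝ} {a M : ℝ}
    (ha : 0 < a) (hM : 0 < M) (hw : ∀ u ∈ Z, 0 ≤ w u) :
    ∫⁻ t in sqrtPotentialBad Z w τ a M, ENNReal.ofReal (1 / t) ≤ ENNReal.ofReal (5 / M) := by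
  set W := ∑ u ∈ Z, w u with hW
  rcases (Finset.sum_nonneg hw).lt_or_eq with hW0 | hW0
  · rw [← hW] at hW0
    calc ∫⁻ t in sqrtPotentialBad Z w τ a M, ENNReal.ofReal (1 / t)
        ≤ ∫⁻ t in sqrtPotentialBad Z w τ a M,
            ENNReal.ofReal (1 / (a * (M * W)) * sqrtPotential Z w τ a t) := by
          apply setLIntegral_mono' (measurableSet_sqrtPotentialBad Z w τ a M)
          rintro t ⟨⟨ht, _⟩, ht'⟩
          apply ENNReal.ofReal_le_ofReal
          have h1 : 1 / t ≤ 1 / a := one_div_le_one_div_of_le ha ht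
          have h2 : 1 / a = 1 / (a * (M * W)) * (M * W) := by field_simp
          refine h1.trans (h2.le.trans ?_)
          apply mul_le_mul_of_nonneg_left (le_of_lt ht')
          positivity
      _ ≤ ∫⁻ t in Icc a (2 * a), ENNReal.ofReal (1 / (a * (M * W)) * sqrtPotential Z w τ a t) :=
          lintegral_mono_set inter_subset_left
      _ = ∫⁻ t in Icc a (2 * a), ∑ u ∈ Z,
            ENNReal.ofReal (1 / (a * (M * W)) * w u) * ENNReal.ofReal √(a / |t - τ u|) := by
          apply lintegral_congr
          intro t
          rw [sqrtPotential, Finset.mul_sum, ENNReal.ofReal_sum_of_nonneg]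
          · apply Finset.sum_congr rfl
            intro u hu
            rw [← mul_assoc, ENNReal.ofReal_mul]
            exact mul_nonneg (by positivity) (hw u hu)
          · intro u hu
            exact mul_nonneg (by positivity) (mul_nonneg (hw u hu) (Real.sqrt_nonneg _))
      _ = ∑ u ∈ Z, ∫⁻ t in Icc a (2 * a),
            ENNReal.ofReal (1 / (a * (M * W)) * w u) * ENNReal.ofReal √(a / |t - τ u|) := by
          apply lintegral_finsetSum
          intro u _
          have : Measurable fun t : ℝ => |t - τ u| := (by fun_prop : Continuous _).measurable
          fun_prop
      _ ≤ ∑ u ∈ Z, ENNReal.ofReal (1 / (a * (M * W)) * w u * (5 * a)) := by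
          apply Finset.sum_le_sum
          intro u hu
          rw [lintegral_const_mul' _ _ ENNReal.ofReal_ne_top,
            ENNReal.ofReal_mul (mul_nonneg (by positivity) (hw u hu))]
          gcongr
          exact setLIntegral_sqrt_div_abs_sub_le ha _
      _ = ENNReal.ofReal (5 / M) := by
          rw [← ENNReal.ofReal_sum_of_nonneg]
          · rw [← Finset.sum_mul, ← Finset.mul_sum, ← hW]
            congr 1
            field_simp
          · intro u hu
            exact mul_nonneg (mul_nonneg (by positivity) (hw u hu)) (by positivity)
  · have hz : ∀ u ∈ Z, w u = 0 := (Finset.sum_eq_zero_iff_of_nonneg hw).1 hW0.symm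
    have : sqrtPotentialBad Z w τ a M = ∅ := by
      ext t
      simp only [sqrtPotentialBad, mem_inter_iff, mem_ofPred_eq, ← hW0, mul_zero,
        mem_empty_iff_false, iff_false, not_and, not_lt]
      intro _
      rw [sqrtPotential, Finset.sum_eq_zero]
      intro u hu
      rw [hz u hu, zero_mul]
    rw [this]
    simp

theorem FiniteLogMeasure.union {E F : Set ℝ} (hE : FiniteLogMeasure E) (hF : FiniteLogMeasure F) :
    FiniteLogMeasure (E ∪ F) := by
  refine ⟨hE.1.union hF.1, ?_⟩
  rw [union_inter_distrib_right]
  exact (lintegral_union_le _ _ _).trans_lt (ENNReal.add_lt_top.2 ⟨hE.2, hF.2⟩)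

theorem Set.Countable.finiteLogMeasure {E : Set ℝ} (hE : E.Countable) : FiniteLogMeasure E := by
  refine ⟨hE.measurableSet, ?_⟩
  rw [setLIntegral_measure_zero _ _ ((hE.mono inter_subset_left).measure_zero _)]
  exact ENNReal.zero_lt_top

theorem finiteLogMeasure_iUnion {E : ℕ → Set ℝ} (hE : ∀ k, MeasurableSet (E k)) {b : ℕ → ℝ}
    (hb : Summable b) (h : ∀ k, ∫⁻ t in E k, ENNReal.ofReal (1 / t) ≤ ENNReal.ofReal (b k)) :
    FiniteLogMeasure (⋃ k, E k) := by
  refine ⟨MeasurableSet.iUnion hE, ?_⟩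
  calc ∫⁻ t in (⋃ k, E k) ∩ Ici 1, ENNReal.ofReal (1 / t)
      ≤ ∫⁻ t in ⋃ k, E k, ENNReal.ofReal (1 / t) := lintegral_mono_set inter_subset_left
    _ ≤ ∑' k, ∫⁻ t in E k, ENNReal.ofReal (1 / t) := lintegral_iUnion_le _ _
    _ ≤ ∑' k, ENNReal.ofReal (b k) := ENNReal.tsum_le_tsum h
    _ < ⊤ := hb.tsum_ofReal_lt_top

theorem countable_divW_ne_zero {f : ℂ → ℂ} (hf : Meromorphic f) : {u | divW f u ≠ 0}.Countable := by
  have : {u | divW f u ≠ 0} ⊆ ⋃ n : ℕ, (zpFinset f n : Set ℂ) := by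
    intro u hu
    obtain ⟨n, hn⟩ := exists_nat_ge ‖u‖
    exact mem_iUnion.2 ⟨n, (mem_zpFinset hf).2 ⟨hn, hu⟩⟩
  exact (countable_iUnion fun n : ℕ => (zpFinset f n).finite_toSet.countable).mono this

/-- This is `log t ≤ t - 1` at `t = √v / M`. Summed against weights with potential at most `M` times
their total, the square roots cost only a constant per unit weight, so the loss is `log M` rather
than a power of `M`. -/
theorem log_sqrt_le {v M : ℝ} (hv : 0 < v) (hM : 0 < M) :
    Real.log v ≤ 2 * (Real.log M + √v / M) := by
  have hs : 0 < √v := Real.sqrt_pos.2 hv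
  have h1 : Real.log v = 2 * Real.log √v := by
    rw [Real.log_sqrt hv.le]; ring
  have h2 := Real.log_le_sub_one_of_pos (div_pos hs hM)
  rw [Real.log_div hs.ne' hM.ne'] at h2
  linarith

/-- On `[2^k, 2^(k+1)]` the threshold is `M = (k+1)²`: then `5/M` is summable, while `log M = O(1 +
log log r)`. The growth hypothesis serves to replace `‖y‖` by `κ r`: off the exceptional set no `τ
u` is closer to `r` than `a / (M W)²`, and `W ≤ √r` makes this at least a negative power of `log r`
up to a constant, which dominates the error `C / r`. -/
theorem exists_exceptional_set {f : ℂ → ℂ} (hf : Meromorphic f) {κ A B C : ℝ} (hκ : 0 < κ)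
    (hA : 0 < A) (hB : 0 < B) (hC : 0 ≤ C) (hgrow : ∀ᶠ r in atTop, zpCount f (2 * A * r) ≤ √r) :
    ∃ E : Set ℝ, FiniteLogMeasure E ∧ ∃ c : ℝ, 0 ≤ c ∧ ∀ᶠ r in atTop, r ∉ E → ∀ y : ℂ,
      |‖y‖ - κ * r| ≤ C / r →
      ∑ u ∈ zpFinset f (A * r), divW f u * Real.log (B * r / ‖y - u‖) ≤
        c * (1 + Real.log (Real.log r)) * zpCount f (2 * A * r) := by
  set τ : ℂ → ℝ := fun u => ‖u‖ / κ with hτ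
  set Z : ℕ → Finset ℂ := fun k => zpFinset f (A * 2 ^ (k + 1)) with hZ
  set E₁ : Set ℝ := ⋃ k : ℕ, sqrtPotentialBad (Z k) (divW f) τ (2 ^ k) ((k + 1 : ℝ) ^ 2) with hE₁
  -- The radii with `r = τ u` are removed separately, since there the potential takes the value `0`
  -- instead of `∞` in the term of `u`.
  set E₂ : Set ℝ := τ '' {u | divW f u ≠ 0} with hE₂
  have hfin₁ : FiniteLogMeasure E₁ := by
    apply finiteLogMeasure_iUnion (b := fun k : ℕ => 5 / ((k + 1 : ℝ) ^ 2))
    · have := (summable_nat_add_iff 1).2 (Real.summable_one_div_nat_pow.2 (one_lt_two))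
      simpa [div_eq_mul_inv] using this.mul_left 5
    · intro k
      exact setLIntegral_sqrtPotentialBad_le _ (by positivity) (by positivity)
        fun u _ => divW_nonneg f u
    · intro k
      exact measurableSet_sqrtPotentialBad _ _ _ _ _
  have hfin₂ : FiniteLogMeasure E₂ := ((countable_divW_ne_zero hf).image τ).finiteLogMeasure
  refine ⟨E₁ ∪ E₂, hfin₁.union hfin₂, |Real.log (4 * B / κ)| + 20, by positivity, ?_⟩
  have hlog4 : ∀ᶠ r : ℝ in atTop, 4 * C * (3 * Real.log r) ^ 4 ≤ κ * r := by
    have h := (Real.isLittleO_pow_log_id_atTop (n := 4)).bound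
      (show (0 : ℝ) < κ / (4 * C * 81 + 1) by positivity)
    filter_upwards [h, eventually_ge_atTop 1] with r hr hr1
    rw [Real.norm_of_nonneg (by positivity), id, Real.norm_of_nonneg (by linarith)] at hr
    have h2 : (4 * C * 81 + 1) * Real.log r ^ 4 ≤ κ * r := by
      have := mul_le_mul_of_nonneg_left hr (show (0 : ℝ) ≤ 4 * C * 81 + 1 by positivity)
      refine this.trans (le_of_eq ?_)
      field_simp
    nlinarith [show 0 ≤ Real.log r ^ 4 by positivity]
  filter_upwards [hgrow, hlog4, eventually_ge_atTop (Real.exp 1)] with r hW hlr hre hrE y hy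
  have hr1 : 1 ≤ r := le_trans (by
    have := Real.add_one_le_exp (1 : ℝ); linarith) hre
  have hr0 : 0 < r := by linarith
  have hlog1 : 1 ≤ Real.log r := by
    rw [Real.le_log_iff_exp_le hr0]; exact hre
  have hll : 0 ≤ Real.log (Real.log r) := Real.log_nonneg hlog1
  obtain ⟨k, hk1, hk2⟩ := exists_nat_pow_near hr1 (one_lt_two (α := ℝ))
  have hkr : (k : ℝ) + 1 ≤ 3 * Real.log r := by
    have h1 : (k : ℝ) * Real.log 2 ≤ Real.log r := by
      rw [← Real.log_pow]
      exact Real.log_le_log (by positivity) hk1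
    have h2 : (1 / 2 : ℝ) ≤ Real.log 2 := by linarith [Real.log_two_gt_d9]
    have h3 : (k : ℝ) * (1 / 2) ≤ k * Real.log 2 := by gcongr
    linarith
  set M : ℝ := ((k : ℝ) + 1) ^ 2 with hM
  have hM1 : 1 ≤ M := by
    rw [hM]; nlinarith [show (0 : ℝ) ≤ k from k.cast_nonneg]
  have hM0 : 0 < M := by linarith
  have hlogM : Real.log M ≤ 4 + 2 * Real.log (Real.log r) := by
    rw [hM, Real.log_pow]
    have h1 : Real.log ((k : ℝ) + 1) ≤ Real.log 3 + Real.log (Real.log r) := by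
      rw [← Real.log_mul (by norm_num) (by linarith)]
      exact Real.log_le_log (by positivity) hkr
    have := Real.log_le_sub_one_of_pos (show (0 : ℝ) < 3 by norm_num)
    push_cast
    linarith
  set a : ℝ := 2 ^ k with ha
  have ha0 : 0 < a := by positivity
  have hra : r ≤ 2 * a := by rw [ha]; rw [pow_succ] at hk2; linarith
  set W : ℝ := ∑ u ∈ Z k, divW f u with hWdef
  have hWle : W ≤ zpCount f (2 * A * r) := by
    apply zpCount_mono hf
    rw [pow_succ]
    nlinarith
  have hpot : sqrtPotential (Z k) (divW f) τ a r ≤ M * W := by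
    by_contra hcon
    push Not at hcon
    exact hrE (Or.inl (mem_iUnion.2 ⟨k, ⟨hk1, hra⟩, hcon⟩))
  have hnn : ∀ u, 0 ≤ divW f u * √(a / |r - τ u|) := fun u =>
    mul_nonneg (divW_nonneg _ _) (Real.sqrt_nonneg _)
  have hsub : zpFinset f (A * r) ⊆ Z k := by
    apply zpFinset_mono hf
    exact mul_le_mul_of_nonneg_left hk2.le hA.le
  have hterm : ∀ u ∈ zpFinset f (A * r), divW f u * Real.log (B * r / ‖y - u‖) ≤
      divW f u * (|Real.log (4 * B / κ)| + 2 * Real.log M)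
        + 2 / M * (divW f u * √(a / |r - τ u|)) := by
    intro u hu
    have hu' := (mem_zpFinset hf).1 hu
    have hne : r ≠ τ u := fun h => hrE (Or.inr ⟨u, hu'.2, h.symm⟩)
    have hd : 0 < |r - τ u| := abs_pos.2 (sub_ne_zero.2 hne)
    -- Multiplicities are at least `1`, so a single term of the potential already bounds the
    -- distance from `r` to `τ u` from below.
    have hsq : √(a / |r - τ u|) ≤ M * W := by
      refine le_trans ?_ hpot
      refine le_trans ?_ (Finset.single_le_sum (fun v _ => hnn v) (hsub hu))
      exact le_mul_of_one_le_left (Real.sqrt_nonneg _) (one_le_divW hu'.2)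
    have hsq2 : a ≤ (M * W) ^ 2 * |r - τ u| := by
      rw [← div_le_iff₀ hd]
      exact (Real.sqrt_le_left (le_trans (Real.sqrt_nonneg _) hsq)).1 hsq
    have hW0 : 0 ≤ W := Finset.sum_nonneg fun u _ => divW_nonneg f u
    have hW2 : W ^ 2 ≤ r := by
      rw [← Real.le_sqrt hW0 hr0.le]
      exact hWle.trans hW
    have hM2 : M ^ 2 ≤ (3 * Real.log r) ^ 4 := by
      rw [hM, ← pow_mul]
      exact pow_le_pow_left₀ (by positivity) hkr 4
    have hCr : C / r ≤ κ * |r - τ u| / 2 := by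
      rw [div_le_div_iff₀ hr0 two_pos]
      have h1 : r / 2 ≤ (M ^ 2 * r) * |r - τ u| := by
        have : (M * W) ^ 2 ≤ M ^ 2 * r := by
          rw [mul_pow]; gcongr
        nlinarith
      have h3 : r / 2 ≤ ((3 * Real.log r) ^ 4 * r) * |r - τ u| := h1.trans (by gcongr)
      have h2 : 4 * C * (r / 2) ≤ (4 * C * (3 * Real.log r) ^ 4) * r * |r - τ u| := by
        have := mul_le_mul_of_nonneg_left h3 (show 0 ≤ 4 * C by linarith)
        linarith
      have h4 : (4 * C * (3 * Real.log r) ^ 4) * r * |r - τ u| ≤ κ * r * r * |r - τ u| := by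
        gcongr
      have h5 : r * (C * 2) ≤ r * (κ * |r - τ u| * r) := by linarith
      exact le_of_mul_le_mul_left h5 hr0
    have hyu : κ * |r - τ u| / 2 ≤ ‖y - u‖ := by
      have h1 : κ * |r - τ u| = |κ * r - ‖u‖| := by
        rw [← abs_of_pos hκ, ← abs_mul, abs_of_pos hκ, mul_sub, hτ]
        congr 2
        field_simp
      have h2 := abs_norm_sub_norm_le y u
      have h3 : |κ * r - ‖u‖| ≤ |‖y‖ - κ * r| + |‖y‖ - ‖u‖| := by
        have := abs_sub_le (κ * r) ‖y‖ ‖u‖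
        rwa [abs_sub_comm (κ * r) ‖y‖] at this
      linarith
    have hyu0 : 0 < ‖y - u‖ := lt_of_lt_of_le (by positivity) hyu
    have hX : B * r / ‖y - u‖ ≤ 4 * B / κ * (a / |r - τ u|) := by
      rw [div_le_iff₀ hyu0]
      calc B * r ≤ B * (2 * a) := by gcongr
        _ = 4 * B / κ * (a / |r - τ u|) * (κ * |r - τ u| / 2) := by field_simp; ring
        _ ≤ _ := by gcongr
    have hlogX : Real.log (B * r / ‖y - u‖) ≤ Real.log (4 * B / κ) + Real.log (a / |r - τ u|) := by
      rw [← Real.log_mul (by positivity) (by positivity)]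
      exact Real.log_le_log (by positivity) hX
    have hls := log_sqrt_le (show 0 < a / |r - τ u| by positivity) hM0
    have hfin : Real.log (B * r / ‖y - u‖) ≤ (|Real.log (4 * B / κ)| + 2 * Real.log M)
        + 2 / M * √(a / |r - τ u|) := by
      have := le_abs_self (Real.log (4 * B / κ))
      have e : 2 / M * √(a / |r - τ u|) = 2 * (√(a / |r - τ u|) / M) := by ring
      linarith
    calc _ ≤ divW f u * ((|Real.log (4 * B / κ)| + 2 * Real.log M)
        + 2 / M * √(a / |r - τ u|)) := mul_le_mul_of_nonneg_left hfin (divW_nonneg _ _)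
      _ = _ := by ring
  refine (Finset.sum_le_sum hterm).trans ?_
  rw [Finset.sum_add_distrib, ← Finset.sum_mul, ← Finset.mul_sum]
  have h1 : ∑ u ∈ zpFinset f (A * r), divW f u ≤ zpCount f (2 * A * r) := by
    apply zpCount_mono hf
    nlinarith [mul_pos hA hr0]
  have h2 : ∑ u ∈ zpFinset f (A * r), divW f u * √(a / |r - τ u|) ≤ M * W :=
    (Finset.sum_le_sum_of_subset_of_nonneg hsub fun u _ _ => hnn u).trans hpot
  have h3 : 2 / M * ∑ u ∈ zpFinset f (A * r), divW f u * √(a / |r - τ u|) ≤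
      2 * zpCount f (2 * A * r) := by
    calc _ ≤ 2 / M * (M * W) := by gcongr
      _ = 2 * W := by field_simp
      _ ≤ _ := by linarith
  have hlM : 0 ≤ Real.log M := Real.log_nonneg hM1
  have h4 : (∑ u ∈ zpFinset f (A * r), divW f u) * (|Real.log (4 * B / κ)| + 2 * Real.log M) ≤
      zpCount f (2 * A * r) * (|Real.log (4 * B / κ)| + (8 + 4 * Real.log (Real.log r))) := by
    apply mul_le_mul h1 (by linarith) (by positivity) (zpCount_nonneg _ _)
  have h5 := zpCount_nonneg f (2 * A * r)
  have h6 : 0 ≤ zpCount f (2 * A * r) * Real.log (Real.log r) := mul_nonneg h5 hll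
  have h7 : 0 ≤ zpCount f (2 * A * r) * (|Real.log (4 * B / κ)| * Real.log (Real.log r)) :=
    mul_nonneg h5 (mul_nonneg (abs_nonneg _) hll)
  nlinarith

/-! ### The points `x̂` and `x̌`: size, separation and fibres -/

theorem awCheck_eq_awHat_inv (p z : ℂ) : awCheck p z = awHat p⁻¹ z := by
  simp [awCheck, awHat]

theorem exists_joukowski_preimage (x : ℂ) : ∃ z : ℂ, 1 ≤ ‖z‖ ∧ (z + z⁻¹) / 2 = x := by
  obtain ⟨h0, h⟩ := awZ_spec x
  rcases le_total 1 ‖awZ x‖ with h1 | h1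
  · exact ⟨_, h1, h⟩
  · refine ⟨(awZ x)⁻¹, ?_, by rw [inv_inv, add_comm]; exact h⟩
    rw [norm_inv]
    exact (one_le_inv₀ (norm_pos_iff.2 h0)).2 h1

theorem norm_le_of_joukowski {x z : ℂ} (hx : (z + z⁻¹) / 2 = x) :
    ‖z‖ ≤ 2 * ‖x‖ + 1 := by
  rcases le_total ‖z‖ 1 with h | h
  · linarith [norm_nonneg x]
  · have h1 : z = 2 * x - z⁻¹ := by rw [← hx]; ring
    have h2 : ‖z⁻¹‖ ≤ 1 := by rw [norm_inv]; exact inv_le_one_of_one_le₀ h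
    calc ‖z‖ = ‖2 * x - z⁻¹‖ := by rw [← h1]
      _ ≤ ‖2 * x‖ + ‖z⁻¹‖ := norm_sub_le _ _
      _ ≤ 2 * ‖x‖ + 1 := by rw [norm_mul]; simpa using h2

theorem norm_le_of_joukowski_large {x z : ℂ} (hz : 1 ≤ ‖z‖) (hx : (z + z⁻¹) / 2 = x) :
    ‖x‖ ≤ ‖z‖ := by
  have h1 : 2 * x = z + z⁻¹ := by rw [← hx]; ring
  have h2 : ‖z⁻¹‖ ≤ 1 := by rw [norm_inv]; exact inv_le_one_of_one_le₀ hz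
  have h3 : ‖2 * x‖ ≤ ‖z‖ + ‖z⁻¹‖ := by rw [h1]; exact norm_add_le _ _
  rw [norm_mul] at h3
  norm_num at h3
  norm_num at h2
  linarith

/-- Exactly, `x̂ - p x = (p⁻¹ - p) / (2 z)`, and `|z| ≥ |x|` for the solution with `|z| ≥ 1`.
Replacing `p` by `p⁻¹` covers `x̌`. -/
theorem abs_norm_awHat_sub_le {p x z : ℂ} (hz : 1 ≤ ‖z‖) (hx : (z + z⁻¹) / 2 = x)
    (h1x : 1 ≤ ‖x‖) : |‖awHat p z‖ - ‖p‖ * ‖x‖| ≤ ‖p⁻¹ - p‖ / 2 / ‖x‖ := by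
  have h1 : awHat p z - p * x = (p⁻¹ - p) / 2 * z⁻¹ := by
    rw [← hx, awHat]; ring
  rw [← norm_mul]
  refine (abs_norm_sub_norm_le _ _).trans ?_
  rw [h1, norm_mul, norm_div, norm_inv, RCLike.norm_ofNat, ← div_eq_mul_inv]
  exact div_le_div_of_nonneg_left (by positivity) (by linarith)
    (norm_le_of_joukowski_large hz hx)

theorem awHat_sub_awCheck_norm_ge {p x z : ℂ} (hz : 1 ≤ ‖z‖) (hx : (z + z⁻¹) / 2 = x) :
    ‖p - p⁻¹‖ / 2 * (‖x‖ - 1) ≤ ‖awHat p z - awCheck p z‖ := by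
  have h1 : awHat p z - awCheck p z = (p - p⁻¹) / 2 * (z - z⁻¹) := by
    rw [awHat, awCheck]; ring
  rw [h1, norm_mul, norm_div, RCLike.norm_ofNat]
  apply mul_le_mul_of_nonneg_left _ (by positivity)
  have h2 : ‖z⁻¹‖ ≤ 1 := by rw [norm_inv]; exact inv_le_one_of_one_le₀ hz
  have := norm_sub_norm_le z z⁻¹
  linarith [norm_le_of_joukowski_large hz hx]

/-- The fibre consists of roots of `p z² - 2 b z + p⁻¹`, which is not the zero polynomial. -/
theorem finite_awHat_fibre {p : ℂ} (hp : p ≠ 0) (b : ℂ) : {z | z ≠ 0 ∧ awHat p z = b}.Finite := by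
  set P : Polynomial ℂ := Polynomial.C p * Polynomial.X ^ 2 - Polynomial.C (2 * b) * Polynomial.X
    + Polynomial.C p⁻¹ with hP
  have hP0 : P ≠ 0 := by
    intro h
    have := congrArg (Polynomial.eval 0) h
    simp [hP, hp] at this
  apply P.roots.toFinset.finite_toSet.subset
  rintro z ⟨hz, h⟩
  rw [Finset.mem_coe, Multiset.mem_toFinset, Polynomial.mem_roots hP0, Polynomial.IsRoot, hP]
  simp only [Polynomial.eval_add, Polynomial.eval_sub, Polynomial.eval_mul, Polynomial.eval_C,
    Polynomial.eval_pow, Polynomial.eval_X]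
  rw [← h, awHat]
  field_simp
  ring

/-- The points `x` such that `x̂` lies in `N` for some choice of `z`. -/
def awPreimage (p : ℂ) (N : Set ℂ) : Set ℂ :=
  (fun z => (z + z⁻¹) / 2) '' {z | z ≠ 0 ∧ awHat p z ∈ N}

theorem mem_awPreimage {p x z : ℂ} {N : Set ℂ} (hz : 1 ≤ ‖z‖) (hx : (z + z⁻¹) / 2 = x)
    (h : awHat p z ∈ N) : x ∈ awPreimage p N := by
  refine ⟨z, ⟨?_, h⟩, hx⟩
  rintro rfl
  norm_num at hz

theorem countable_awPreimage {p : ℂ} (hp : p ≠ 0) {N : Set ℂ} (hN : N.Countable) :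
    (awPreimage p N).Countable := by
  apply Countable.image
  have : {z | z ≠ 0 ∧ awHat p z ∈ N} ⊆ ⋃ b ∈ N, {z | z ≠ 0 ∧ awHat p z = b} := by
    rintro z ⟨h0, h⟩
    exact mem_iUnion₂.2 ⟨_, h, h0, rfl⟩
  exact (hN.biUnion fun b _ => (finite_awHat_fibre hp b).countable).mono this

theorem finite_awPreimage {p : ℂ} (hp : p ≠ 0) {N : Set ℂ} (hN : N.Finite) :
    (awPreimage p N).Finite := by
  apply Finite.image
  have : {z | z ≠ 0 ∧ awHat p z ∈ N} ⊆ ⋃ b ∈ N, {z | z ≠ 0 ∧ awHat p z = b} := by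
    rintro z ⟨h0, h⟩
    exact mem_iUnion₂.2 ⟨_, h, h0, rfl⟩
  exact (hN.biUnion fun b _ => finite_awHat_fibre hp b).subset this

theorem norm_awHat_le {p x z : ℂ} (hx : (z + z⁻¹) / 2 = x) :
    ‖awHat p z‖ ≤ (‖p‖ + ‖p⁻¹‖) * (2 * ‖x‖ + 1) := by
  have h1 := norm_le_of_joukowski hx
  have h2 : ‖z⁻¹‖ ≤ 2 * ‖x‖ + 1 := norm_le_of_joukowski (by rw [inv_inv, add_comm]; exact hx)
  calc ‖awHat p z‖ = ‖p * z + p⁻¹ * z⁻¹‖ / 2 := by rw [awHat, norm_div, RCLike.norm_ofNat]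
    _ ≤ ‖p * z + p⁻¹ * z⁻¹‖ := by linarith [norm_nonneg (p * z + p⁻¹ * z⁻¹)]
    _ ≤ ‖p‖ * ‖z‖ + ‖p⁻¹‖ * ‖z⁻¹‖ := by
      rw [← norm_mul, ← norm_mul]; exact norm_add_le _ _
    _ ≤ ‖p‖ * (2 * ‖x‖ + 1) + ‖p⁻¹‖ * (2 * ‖x‖ + 1) := by gcongr
    _ = _ := by ring

theorem codiscrete_compl_inter_ball_finite {S : Set ℂ} (hS : S ∈ codiscrete ℂ) (M : ℝ) :
    (Sᶜ ∩ Metric.closedBall 0 M).Finite := by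
  rw [inter_comm]
  exact (isCompact_closedBall (0 : ℂ) M).finite_sdiff_of_mem_codiscreteWithin
    (codiscreteWithin_mono (subset_univ _) hS)

theorem countable_compl_of_mem_codiscrete {S : Set ℂ} (hS : S ∈ codiscrete ℂ) :
    Sᶜ.Countable := by
  have : Sᶜ ⊆ ⋃ n : ℕ, (Sᶜ ∩ Metric.closedBall 0 n) := by
    intro u hu
    obtain ⟨n, hn⟩ := exists_nat_ge ‖u‖
    exact mem_iUnion.2 ⟨n, hu, by simpa using hn⟩
  exact (countable_iUnion fun n : ℕ =>
    (codiscrete_compl_inter_ball_finite hS n).countable).mono this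

/-- Used contrapositively, this turns `𝒟_q f ≢ 0` into nonconstancy of `f`. Near any `x`, the points
`x̂` and `x̌` stay in a fixed disc, which holds finitely many exceptions to `f = c`; by finiteness
of fibres only finitely many points `y` near `x` are affected. -/
theorem awOperator_eq_zero_of_const {p : ℂ} (hp : p ≠ 0) {f : ℂ → ℂ} {c : ℂ}
    (hf : f =ᶠ[codiscrete ℂ] fun _ => c) : awOperator p f =ᶠ[codiscrete ℂ] 0 := by
  set S : Set ℂ := {x | f x = c} with hS
  have hS' : S ∈ codiscrete ℂ := hf
  rw [Filter.EventuallyEq, Filter.Eventually, mem_codiscrete]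
  intro x
  rw [disjoint_principal_right, compl_compl]
  set M : ℝ := (‖p‖ + ‖p⁻¹‖) * (2 * (‖x‖ + 1) + 1) with hM
  set N := Sᶜ ∩ Metric.closedBall 0 M with hN
  have hNf : N.Finite := codiscrete_compl_inter_ball_finite hS' M
  have hB : (awPreimage p N ∪ awPreimage p⁻¹ N ∪ {1, -1} : Set ℂ).Finite :=
    ((finite_awPreimage hp hNf).union (finite_awPreimage (inv_ne_zero hp) hNf)).union
      (by simp)
  have h1 : ∀ᶠ y in 𝓝[≠] x, y ∉ (awPreimage p N ∪ awPreimage p⁻¹ N ∪ {1, -1} : Set ℂ) := by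
    have := (hB.subset (sdiff_subset (t := {x}))).isClosed.isOpen_compl.mem_nhds
      (show x ∈ ((awPreimage p N ∪ awPreimage p⁻¹ N ∪ {1, -1} : Set ℂ) \ {x})ᶜ by simp)
    filter_upwards [mem_nhdsWithin_of_mem_nhds this, self_mem_nhdsWithin] with y hy hyx hy'
    exact hy ⟨hy', hyx⟩
  have h2 : ∀ᶠ y in 𝓝[≠] x, ‖y‖ ≤ ‖x‖ + 1 := by
    have : Metric.ball x 1 ∈ 𝓝[≠] x := mem_nhdsWithin_of_mem_nhds (Metric.ball_mem_nhds x one_pos)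
    filter_upwards [this] with y hy
    have h3 : ‖y - x‖ < 1 := by simpa [dist_eq_norm] using hy
    have := norm_sub_norm_le y x
    linarith
  filter_upwards [h1, h2] with y hy1 hy2
  simp only [mem_union, not_or, mem_insert_iff, mem_singleton_iff] at hy1
  obtain ⟨⟨hp1, hp2⟩, hy3, hy4⟩ := hy1
  obtain ⟨z, hz, hzy⟩ := exists_joukowski_preimage y
  have hz0 : z ≠ 0 := by rintro rfl; norm_num at hz
  have key : ∀ p' : ℂ, ‖p'‖ + ‖p'⁻¹‖ = ‖p‖ + ‖p⁻¹‖ → y ∉ awPreimage p' N →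
      f (awHat p' z) = c := by
    intro p' hp' hy'
    by_contra hc
    apply hy'
    refine mem_awPreimage hz hzy ⟨hc, ?_⟩
    rw [mem_closedBall_zero_iff]
    refine (norm_awHat_le hzy).trans ?_
    rw [hp', hM]
    gcongr
  show awOperator p f y = 0
  rw [awOperator_eq p f hy3 hy4 hz0 hzy, awCheck_eq_awHat_inv, key p rfl hp1,
    key p⁻¹ (by rw [inv_inv, add_comm]) hp2, sub_self, zero_div]

/-! ### The pointwise estimate of the quotient -/

theorem posLog_norm_div_le {a b : ℂ} (ha : a ≠ 0) (hb : b ≠ 0) :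
    Real.posLog ‖a / b‖ ≤ |Real.log ‖a‖ - Real.log ‖b‖| := by
  rw [Real.posLog, norm_div, Real.log_div (norm_ne_zero_iff.2 ha) (norm_ne_zero_iff.2 hb)]
  exact max_le (abs_nonneg _) (le_abs_self _)

theorem posLog_awOperator_div_le {p x z : ℂ} {f : ℂ → ℂ} (hz : 1 ≤ ‖z‖) (hx : (z + z⁻¹) / 2 = x)
    (h1x : 1 < ‖x‖) (hdist : 1 ≤ ‖awHat p z - awCheck p z‖) (h0 : f x ≠ 0)
    (h1 : f (awHat p z) ≠ 0) (h2 : f (awCheck p z) ≠ 0) :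
    Real.posLog ‖awOperator p f x / f x‖ ≤ Real.log 2
      + |Real.log ‖f (awHat p z)‖ - Real.log ‖f x‖|
      + |Real.log ‖f (awCheck p z)‖ - Real.log ‖f x‖| := by
  have hz0 : z ≠ 0 := by rintro rfl; norm_num at hz
  have hx1 : x ≠ 1 := by rintro rfl; norm_num at h1x
  have hx2 : x ≠ -1 := by rintro rfl; norm_num at h1x
  rw [awOperator_eq p f hx1 hx2 hz0 hx]
  have hle : ‖(f (awHat p z) - f (awCheck p z)) / (awHat p z - awCheck p z) / f x‖ ≤
      ‖f (awHat p z) / f x‖ + ‖f (awCheck p z) / f x‖ := by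
    rw [div_right_comm, norm_div, sub_div]
    exact (div_le_self (norm_nonneg _) hdist).trans (norm_sub_le _ _)
  refine (Real.posLog_le_posLog (norm_nonneg _) hle).trans (Real.posLog_add.trans ?_)
  linarith [posLog_norm_div_le h1 h0, posLog_norm_div_le h2 h0]

set_option maxHeartbeats 400000 in
theorem exists_posLog_awOperator_div_le {p : ℂ} (hp0 : p ≠ 0) (hp1 : ‖p‖ < 1) {f : ℂ → ℂ}
    (hf : Meromorphic f) (hne : ∀ z, meromorphicOrderAt f z ≠ ⊤)
    (hgrow : ∀ A : ℝ, 0 < A → ∀ᶠ r in atTop, zpCount f (A * r) ≤ √r) :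
    ∃ E : Set ℝ, FiniteLogMeasure E ∧ ∃ K c : ℝ, 1 ≤ K ∧ 0 ≤ c ∧ ∀ᶠ r in atTop, r ∉ E →
      ∀ x : ℂ, ‖x‖ = r → ∀ R : ℝ, K * r ≤ R →
        Real.posLog ‖awOperator p f x / f x‖ ≤ c * (1 +
          r / R * (ValueDistribution.characteristic f ⊤ R + 1)
          + (1 + Real.log (Real.log r)) * zpCount f R) := by
  set N : Set ℂ := {x | RegularPt f x}ᶜ with hN
  have hNc : N.Countable := countable_compl_of_mem_codiscrete (regularPt_codiscrete hf hne)
  set E₀ : Set ℝ := (fun x : ℂ => ‖x‖) '' (N ∪ awPreimage p N ∪ awPreimage p⁻¹ N) with hE₀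
  have hE₀f : FiniteLogMeasure E₀ := (((hNc.union (countable_awPreimage hp0 hNc)).union
    (countable_awPreimage (inv_ne_zero hp0) hNc)).image _).finiteLogMeasure
  have hpn : 0 < ‖p‖ := norm_pos_iff.2 hp0
  have hpi : 1 < ‖p⁻¹‖ := by rw [norm_inv]; exact (one_lt_inv₀ hpn).2 hp1
  set L : ℝ := 2 * ‖p⁻¹‖ with hL
  have hL2 : 2 < L := by linarith
  set C : ℝ := ‖p⁻¹ - p‖ / 2 with hC
  have hC0 : 0 < C := by
    have : p⁻¹ - p ≠ 0 := by
      intro h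
      rw [sub_eq_zero] at h
      rw [h] at hpi
      linarith
    have := norm_pos_iff.2 this
    positivity
  have hg := hgrow (2 * (2 * L)) (by linarith)
  have hex : ∀ κ : ℝ, 0 < κ → _ := fun κ hκ => exists_exceptional_set hf (A := 2 * L)
    (B := 3 * L) (C := C) hκ (by linarith) (by linarith) hC0.le hg
  obtain ⟨E₁, hE₁, c₁, hc₁, h₁⟩ := hex 1 one_pos
  obtain ⟨E₂, hE₂, c₂, hc₂, h₂⟩ := hex ‖p‖ hpn
  obtain ⟨E₃, hE₃, c₃, hc₃, h₃⟩ := hex ‖p⁻¹‖ (by linarith)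
  obtain ⟨C₀, hprox⟩ := proximity_add_proximity_le hf
  -- With `L = 2‖p⁻¹‖`, the radius `L r` bounds `x`, `x̂` and `x̌`; the near zeros and poles lie
  -- within `2 L r`; and the estimate of their sum counts up to `4 L r`, hence `K = 4 L`. The set
  -- `E₀` removes the radii at which one of the three points may fail to be regular.
  refine ⟨E₀ ∪ E₁ ∪ E₂ ∪ E₃, ((hE₀f.union hE₁).union hE₂).union hE₃, 2 * (2 * L),
    16 * L * (2 + |C₀|) + 2 * (4 + c₁) + c₂ + c₃ + 1, by linarith, by positivity, ?_⟩
  filter_upwards [h₁, h₂, h₃, eventually_ge_atTop (Real.exp 1), eventually_ge_atTop C,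
    eventually_ge_atTop (1 + 1 / C)] with r h₁ h₂ h₃ hre hrC hrC' hrE x hxr R hR
  simp only [mem_union, not_or] at hrE
  obtain ⟨⟨⟨hr0, hr1⟩, hr2⟩, hr3⟩ := hrE
  have hr2' : 2 ≤ r := le_trans (by
    have := Real.add_one_le_exp (1 : ℝ); linarith) hre
  have hrpos : 0 < r := by linarith
  have hlog1 : 1 ≤ Real.log r := by
    rw [Real.le_log_iff_exp_le hrpos]; exact hre
  have hll : 0 ≤ Real.log (Real.log r) := Real.log_nonneg hlog1
  obtain ⟨z, hz, hzx⟩ := exists_joukowski_preimage x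
  have h1x : 1 ≤ ‖x‖ := by linarith
  have hxN : ∀ y ∈ (N ∪ awPreimage p N ∪ awPreimage p⁻¹ N), ‖y‖ ≠ r := fun y hy h =>
    hr0 ⟨y, hy, h⟩
  have hregx : RegularPt f x := by
    by_contra h
    exact hxN x (Or.inl (Or.inl h)) hxr
  have hregh : RegularPt f (awHat p z) := by
    by_contra h
    exact hxN x (Or.inl (Or.inr (mem_awPreimage hz hzx h))) hxr
  have hregc : RegularPt f (awCheck p z) := by
    by_contra h
    rw [awCheck_eq_awHat_inv] at h
    exact hxN x (Or.inr (mem_awPreimage hz hzx h)) hxr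
  have hdist : 1 ≤ ‖awHat p z - awCheck p z‖ := by
    refine le_trans ?_ (awHat_sub_awCheck_norm_ge hz hzx)
    rw [hxr, norm_sub_rev, ← hC]
    have : 1 / C ≤ r - 1 := by linarith
    rw [div_le_iff₀ hC0] at this
    linarith
  have hmain := posLog_awOperator_div_le hz hzx (by linarith) hdist hregx.2 hregh.2 hregc.2
  have hCr : C / r ≤ 1 := by rw [div_le_one hrpos]; exact hrC
  have hhat : |‖awHat p z‖ - ‖p‖ * r| ≤ C / r := by
    rw [← hxr]; exact abs_norm_awHat_sub_le hz hzx h1x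
  have hchk : |‖awCheck p z‖ - ‖p⁻¹‖ * r| ≤ C / r := by
    have := abs_norm_awHat_sub_le (p := p⁻¹) hz hzx h1x
    rwa [inv_inv, norm_sub_rev, hxr, ← awCheck_eq_awHat_inv] at this
  have hxx : |‖x‖ - 1 * r| ≤ C / r := by
    rw [hxr, one_mul, sub_self, abs_zero]; positivity
  have hpr : r ≤ ‖p⁻¹‖ * r := le_mul_of_one_le_left hrpos.le hpi.le
  have hLr : L * r = ‖p⁻¹‖ * r + ‖p⁻¹‖ * r := by rw [hL]; ring
  have hb1 : ‖x‖ ≤ L * r := by linarith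
  have hb2 : ‖awHat p z‖ ≤ L * r := by
    have h4 := (abs_le.1 hhat).2
    have h5 : ‖p‖ * r ≤ 1 * r := by gcongr
    linarith
  have hb3 : ‖awCheck p z‖ ≤ L * r := by
    have h4 := (abs_le.1 hchk).2
    linarith
  have hLr0 : 0 < L * r := by positivity
  have hR2 : 2 * (L * r) ≤ R := by linarith
  have hR1 : 1 ≤ R := by linarith
  have hR0 : 0 < R := by linarith
  have e1 : 2 * (L * r) = 2 * L * r := by ring
  have e2 : 3 * (L * r) = 3 * L * r := by ring
  have hcount : zpCount f (2 * (2 * L) * r) ≤ zpCount f R := zpCount_mono hf hR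
  have hn0 := zpCount_nonneg f R
  have hT0 : 0 ≤ ValueDistribution.characteristic f ⊤ R :=
    ValueDistribution.characteristic_nonneg hR1
  set T := ValueDistribution.characteristic f ⊤ R with hT
  set n := zpCount f R with hn
  set l := Real.log (Real.log r) with hl
  clear_value T n l
  have hnear : ∀ c : ℝ, 0 ≤ c → ∀ s : ℝ, s ≤ c * (1 + l) * zpCount f (2 * (2 * L) * r) →
      s ≤ c * ((1 + l) * n) := by
    intro c hc s hs
    refine hs.trans ?_
    rw [mul_assoc]
    gcongr
  have hs₁ := hnear c₁ hc₁ _ (h₁ hr1 x hxx)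
  have hs₂ := hnear c₂ hc₂ _ (h₂ hr2 _ hhat)
  have hs₃ := hnear c₃ hc₃ _ (h₃ hr3 _ hchk)
  have hd₂ := abs_log_norm_sub_le hf hne hLr0 hR2 hb2 hb1 hregh hregx
  have hd₃ := abs_log_norm_sub_le hf hne hLr0 hR2 hb3 hb1 hregc hregx
  rw [e1, e2] at hd₂ hd₃
  simp only [mul_add, Finset.sum_add_distrib] at hd₂ hd₃
  have hpx := hprox R hR1
  have hkern : 8 * (L * r) / R * Real.circleAverage |fun z => Real.log ‖f z‖| 0 R ≤
      8 * L * (2 + |C₀|) * (r / R * (T + 1)) := by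
    have h5 : Real.circleAverage |fun z => Real.log ‖f z‖| 0 R ≤ (2 + |C₀|) * (T + 1) := by
      have := le_abs_self C₀
      linarith [mul_nonneg (abs_nonneg C₀) hT0]
    calc _ ≤ 8 * (L * r) / R * ((2 + |C₀|) * (T + 1)) := by gcongr
      _ = _ := by ring
  have hk0 : 0 ≤ r / R * (T + 1) := by positivity
  have hln : n ≤ (1 + l) * n := le_mul_of_one_le_left hn0 (by linarith)
  have hln0 : 0 ≤ (1 + l) * n := mul_nonneg (by linarith) hn0
  have hlog2 : Real.log 2 ≤ 1 := by linarith [Real.log_two_lt_d9]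
  set X := r / R * (T + 1) with hX
  set Y := (1 + l) * n with hY
  clear_value X Y
  have hfin : Real.posLog ‖awOperator p f x / f x‖ ≤
      1 + 16 * L * (2 + |C₀|) * X + (2 * (4 + c₁) + c₂ + c₃) * Y := by
    linarith
  refine hfin.trans ?_
  set a := 16 * L * (2 + |C₀|) with ha
  have ha0 : 0 ≤ a := by positivity
  set b := 2 * (4 + c₁) + c₂ + c₃ with hb
  have hb0 : 0 ≤ b := by positivity
  have e3 : a + 2 * (4 + c₁) + c₂ + c₃ + 1 = a + b + 1 := by rw [hb]; ring
  rw [e3]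
  linarith [mul_nonneg ha0 hln0, mul_nonneg hb0 hk0]

/-! ### Lower bound for the characteristic -/

theorem meromorphicOrderAt_sub_const_ne_top {f : ℂ → ℂ} (hf : Meromorphic f)
    (hconst : ∀ c : ℂ, ¬ f =ᶠ[codiscrete ℂ] fun _ => c) (c z : ℂ) :
    meromorphicOrderAt (fun w => f w - c) z ≠ ⊤ := by
  have hg : Meromorphic fun w => f w - c := fun w => (hf w).sub (MeromorphicAt.const c w)
  intro h
  apply hconst c
  have hall : ∀ u, meromorphicOrderAt (fun w => f w - c) u = ⊤ := by
    intro u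
    by_contra hu
    exact hg.exists_meromorphicOrderAt_ne_top_iff_forall.1 ⟨u, hu⟩ z h
  rw [Filter.EventuallyEq, Filter.Eventually, mem_codiscrete]
  intro x
  rw [disjoint_principal_right, compl_compl]
  filter_upwards [meromorphicOrderAt_eq_top_iff.1 (hall x)] with y hy using sub_eq_zero.1 hy

/-- Subtracting the value of `f` at a point `z₀` of analyticity creates a zero, which contributes at
least `log r - log‖z₀‖` to the counting function. The first main theorem carries this back to `f`.
-/
theorem exists_log_le_characteristic {f : ℂ → ℂ} (hf : Meromorphic f)
    (hconst : ∀ c : ℂ, ¬ f =ᶠ[codiscrete ℂ] fun _ => c) :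
    ∃ C : ℝ, ∀ᶠ r in atTop, Real.log r - C ≤ ValueDistribution.characteristic f ⊤ r := by
  classical
  have han : {z | AnalyticAt ℂ f z} ∈ codiscrete ℂ := by
    rw [mem_codiscrete]
    intro x
    rw [disjoint_principal_right, compl_compl]
    exact (hf x).eventually_analyticAt
  obtain ⟨z₀, hz₀⟩ : ∃ z₀, AnalyticAt ℂ f z₀ := by
    by_contra h
    push Not at h
    have := countable_compl_of_mem_codiscrete han
    rw [show {z | AnalyticAt ℂ f z} = ∅ by ext z; simp [h z], compl_empty] at this
    exact not_countable_complex this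
  set g : ℂ → ℂ := fun w => f w - f z₀ with hg
  have hgm : Meromorphic g := fun w => (hf w).sub (MeromorphicAt.const _ w)
  have hga : AnalyticAt ℂ g z₀ := hz₀.sub analyticAt_const
  have hone : (1 : ℤ) ≤ MeromorphicOn.divisor g univ z₀ := by
    rw [MeromorphicOn.divisor_apply hgm.meromorphicOn (mem_univ z₀)]
    have h1 := hga.meromorphicOrderAt_nonneg
    have h2 : meromorphicOrderAt g z₀ ≠ 0 := by
      rw [Ne, hga.meromorphicNFAt.meromorphicOrderAt_eq_zero_iff]
      simp [hg]
    have h3 : meromorphicOrderAt g z₀ ≠ ⊤ := meromorphicOrderAt_sub_const_ne_top hf hconst _ _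
    lift meromorphicOrderAt g z₀ to ℤ using h3 with m
    have h1' : 0 ≤ m := by exact_mod_cast h1
    have h2' : m ≠ 0 := by exact_mod_cast h2
    simp only [WithTop.untop₀_coe]
    omega
  have hsingle : Function.locallyFinsuppWithin.single z₀ 1 ≤ (MeromorphicOn.divisor g univ)⁺ := by
    intro u
    rcases eq_or_ne u z₀ with rfl | hu
    · simpa [Function.locallyFinsuppWithin.single_apply] using
        hone.trans (le_posPart (MeromorphicOn.divisor g univ) u)
    · simp [hu, Function.locallyFinsuppWithin.single_apply]
  have hcompare := fun r => (abs_le.1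
    (ValueDistribution.abs_characteristic_sub_characteristic_shift_le (a₀ := f z₀) hf (r := r))).1
  have hinv := fun r => (abs_le.1
    (ValueDistribution.characteristic_sub_characteristic_inv_le hgm (R := r))).1
  refine ⟨Real.log ‖z₀‖ + (max |Real.log ‖g 0‖| |Real.log ‖meromorphicTrailingCoeffAt g 0‖|
    + (Real.posLog ‖f z₀‖ + Real.log 2)), ?_⟩
  filter_upwards [eventually_ge_atTop 1, eventually_ge_atTop ‖z₀‖] with r hr1 hr
  have h1 := Function.locallyFinsuppWithin.logCounting_le hsingle hr1
  rw [Function.locallyFinsuppWithin.logCounting_single_eq_log_sub_const hr,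
    ← ValueDistribution.logCounting_zero, ← ValueDistribution.logCounting_inv] at h1
  have h2 : ValueDistribution.logCounting g⁻¹ ⊤ r ≤ ValueDistribution.characteristic g⁻¹ ⊤ r := by
    have h0 : (0 : ℝ) ≤ ValueDistribution.proximity g⁻¹ ⊤ r := ValueDistribution.proximity_nonneg r
    simp only [ValueDistribution.characteristic, Pi.add_apply]
    linarith
  have h3 := hcompare r
  have h4 := hinv r
  push_cast at h1
  linarith

/-! ### Growth exponents of `φ` and `s` -/

theorem one_add_log_le {δ y : ℝ} (hδ : 0 < δ) (hy : 1 ≤ y) :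
    1 + Real.log y ≤ (1 + 1 / δ) * y ^ δ := by
  have h1 := Real.log_le_rpow_div (by linarith : (0 : ℝ) ≤ y) hδ
  have h2 := Real.one_le_rpow hy hδ.le
  have : (1 + 1 / δ) * y ^ δ = y ^ δ + y ^ δ / δ := by ring
  linarith

/-- Convexity upgrades the upper limit to a limit: one large quotient at `r₂` makes the secant slope
from a fixed `r₁` large, and secant slopes from `r₁` increase. The summand `s r₁` in the threshold
pays for subtracting `s r₁` in that slope. -/
theorem tendsto_div_atTop_of_convexOn {R₀ : ℝ} {s : ℝ → ℝ} (hs_pos : ∀ r ∈ Ioi R₀, 0 < s r)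
    (hlim : limsup (fun r : ℝ => ((s r / r : ℝ) : EReal)) atTop = ⊤)
    (hconv : ConvexOn ℝ (Ioi R₀) s) : Tendsto (fun r => s r / r) atTop atTop := by
  rw [tendsto_atTop]
  intro M'
  set M : ℝ := max M' 0 with hM
  have hM0 : 0 ≤ M := le_max_right _ _
  set r₁ : ℝ := max R₀ 0 + 1 with hr₁
  have hr₁R : r₁ ∈ Ioi R₀ := by
    rw [mem_Ioi, hr₁]; linarith [le_max_left R₀ 0]
  have hr₁1 : 1 ≤ r₁ := by linarith [le_max_right R₀ 0]
  have hs₁ := hs_pos r₁ hr₁R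
  have hfreq := frequently_lt_of_lt_limsup (f := atTop)
    (u := fun r : ℝ => ((s r / r : ℝ) : EReal)) (b := ((M + 1 + s r₁ : ℝ) : EReal))
    (h := by rw [hlim]; exact EReal.coe_lt_top _)
  obtain ⟨r₂, hr₂, hr₂'⟩ := (hfreq.and_eventually (eventually_gt_atTop r₁)).exists
  have hr₂0 : 0 < r₂ := by linarith
  have hr₂R : r₂ ∈ Ioi R₀ := lt_trans hr₁R hr₂'
  have hq : M + 1 + s r₁ < s r₂ / r₂ := by exact_mod_cast hr₂
  rw [lt_div_iff₀ hr₂0] at hq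
  filter_upwards [eventually_gt_atTop r₂, eventually_ge_atTop ((M + 1) * r₁)] with r hr hr'
  have hr0 : 0 < r := by linarith
  have hsec := hconv.secant_mono hr₁R hr₂R (lt_trans hr₂R hr) hr₂'.ne' (by linarith) hr.le
  have h1 : M + 1 ≤ (s r₂ - s r₁) / (r₂ - r₁) := by
    rw [le_div_iff₀ (by linarith)]
    nlinarith
  have h2 := h1.trans hsec
  rw [le_div_iff₀ (by linarith)] at h2
  refine (le_max_left M' 0).trans ?_
  rw [le_div_iff₀ hr0, ← hM]
  nlinarith

theorem eventually_characteristic_le_rpow {φ : ℝ → ℝ} {f : ℂ → ℂ} {ρ ρ' : ℝ}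
    (hφ : Tendsto φ atTop atTop)
    (hT : ∀ᶠ r in atTop, 0 < ValueDistribution.characteristic f ⊤ r)
    (hρ : phiOrder φ f = (ρ : EReal)) (h : ρ < ρ') :
    ∀ᶠ r in atTop, ValueDistribution.characteristic f ⊤ r ≤ φ r ^ ρ' := by
  have h1 : phiOrder φ f < (ρ' : EReal) := by rw [hρ]; exact_mod_cast h
  filter_upwards [eventually_lt_of_limsup_lt h1, hT, hφ.eventually_gt_atTop 1] with r hr hTr hφr
  have hr' : Real.log (ValueDistribution.characteristic f ⊤ r) / Real.log (φ r) < ρ' := by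
    exact_mod_cast hr
  have hl : 0 < Real.log (φ r) := Real.log_pos hφr
  rw [div_lt_iff₀ hl] at hr'
  rw [← Real.log_le_log_iff hTr (Real.rpow_pos_of_pos (by linarith) _),
    Real.log_rpow (by linarith)]
  exact hr'.le

theorem eventually_rpow_le_log_div {φ s : ℝ → ℝ} {γ γ' : ℝ} (hφ : Tendsto φ atTop atTop)
    (hs : ∀ᶠ r in atTop, r < s r) (hγ : growthGamma φ s = (γ : EReal)) (h : γ' < γ) :
    ∀ᶠ r in atTop, φ r ^ γ' ≤ Real.log (s r / r) := by
  have h1 : (γ' : EReal) < growthGamma φ s := by rw [hγ]; exact_mod_cast h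
  filter_upwards [eventually_lt_of_lt_liminf h1, hs, hφ.eventually_gt_atTop 1,
    eventually_gt_atTop 0] with r hr hsr hφr hr0
  have hr' : γ' < Real.log (Real.log (s r / r)) / Real.log (φ r) := by exact_mod_cast hr
  have hl : 0 < Real.log (φ r) := Real.log_pos hφr
  have hlog : 0 < Real.log (s r / r) := Real.log_pos (by rw [lt_div_iff₀ hr0]; linarith)
  rw [lt_div_iff₀ hl] at hr'
  rw [← Real.log_le_log_iff (Real.rpow_pos_of_pos (by linarith) _) hlog,
    Real.log_rpow (by linarith)]
  exact hr'.le

theorem eventually_rpow_comp_le {φ s : ℝ → ℝ} {α α' : ℝ} (hφ : Tendsto φ atTop atTop)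
    (hs : Tendsto s atTop atTop) (hα : growthAlpha φ s = (α : EReal)) (h : α' < α) :
    ∀ᶠ r in atTop, φ (s r) ^ α' ≤ φ r := by
  have h1 : (α' : EReal) < growthAlpha φ s := by rw [hα]; exact_mod_cast h
  filter_upwards [eventually_lt_of_lt_liminf h1, hφ.eventually_gt_atTop 1,
    (hφ.comp hs).eventually_gt_atTop 1] with r hr hφr hφs
  have hr' : α' < Real.log (φ r) / Real.log (φ (s r)) := by exact_mod_cast hr
  simp only [Function.comp_apply] at hφs
  have hl : 0 < Real.log (φ (s r)) := Real.log_pos hφs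
  rw [lt_div_iff₀ hl] at hr'
  rw [← Real.log_le_log_iff (Real.rpow_pos_of_pos (by linarith) _) (by linarith),
    Real.log_rpow (by linarith)]
  exact hr'.le

theorem le_of_eventually_rpow_le {α : Type*} {l : Filter α} [l.NeBot] {u : α → ℝ} {a b c : ℝ}
    (hu : Tendsto u l atTop) (h : ∀ᶠ r in l, u r ^ a ≤ c * u r ^ b) : a ≤ b := by
  by_contra hab
  push Not at hab
  have h1 := ((tendsto_rpow_atTop (sub_pos.2 hab)).comp hu).eventually_gt_atTop c
  obtain ⟨r, hr, hr', hr0⟩ := (h.and (h1.and (hu.eventually_gt_atTop 0))).exists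
  simp only [Function.comp_apply] at hr'
  rw [Real.rpow_sub hr0, lt_div_iff₀ (Real.rpow_pos_of_pos hr0 _)] at hr'
  linarith

theorem growthAlpha_le_one {φ s : ℝ → ℝ} {α : ℝ} (hφ : Tendsto φ atTop atTop)
    (hs : Tendsto s atTop atTop) (hmono : ∀ᶠ r in atTop, φ r ≤ φ (s r))
    (hα : growthAlpha φ s = (α : EReal)) : α ≤ 1 := by
  refine le_of_forall_lt_imp_le_of_dense fun α' h => ?_
  apply le_of_eventually_rpow_le (hφ.comp hs) (c := 1)
  filter_upwards [eventually_rpow_comp_le hφ hs hα h, hmono] with r hr hr'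
  simpa using hr.trans hr'

theorem growthGamma_nonneg {φ s : ℝ → ℝ} {γ : ℝ} (hφ : Tendsto φ atTop atTop)
    (hs : 1 < liminf (fun r : ℝ => ((s r / r : ℝ) : EReal)) atTop)
    (hγ : growthGamma φ s = (γ : EReal)) : 0 ≤ γ := by
  obtain ⟨c, hc1, hc⟩ := EReal.lt_iff_exists_real_btwn.1 hs
  have hc1' : 1 < c := by exact_mod_cast hc1
  have hlc := Real.log_pos hc1'
  refine le_of_forall_lt_imp_le_of_dense fun δ hδ => ?_
  have h : (δ : EReal) ≤ growthGamma φ s := by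
    apply le_liminf_of_le
    · isBoundedDefault
    have h0 : Tendsto (fun r => Real.log (Real.log c) / Real.log (φ r)) atTop (𝓝 0) :=
      (Real.tendsto_log_atTop.comp hφ).const_div_atTop _
    filter_upwards [eventually_lt_of_lt_liminf hc, h0.eventually_const_lt hδ,
      hφ.eventually_gt_atTop 1] with r hr hr' hφr
    have hsr : c < s r / r := by exact_mod_cast hr
    have h1 : Real.log (Real.log c) ≤ Real.log (Real.log (s r / r)) :=
      Real.log_le_log hlc (Real.log_le_log (by linarith) hsr.le)
    have h2 : Real.log (Real.log c) / Real.log (φ r)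
        ≤ Real.log (Real.log (s r / r)) / Real.log (φ r) :=
      div_le_div_of_nonneg_right h1 (Real.log_pos hφr).le
    exact_mod_cast hr'.le.trans h2
  rw [hγ] at h
  exact_mod_cast h

/-- Since `s(r) ≤ r²`, eventually `φ^γ' ≤ log(s(r)/r) ≤ log r ≤ 2 (log r - C) ≤ 2 T(r) ≤ 2 φ^ρ'`.
Together with `α ≤ 1` this makes `ρ - αγ` nonnegative, so that the summand `1` in case (a) can be
absorbed. -/
theorem growthGamma_le_phiOrder {φ s : ℝ → ℝ} {f : ℂ → ℂ} {ρ γ C : ℝ}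
    (hφ : Tendsto φ atTop atTop)
    (hT : ∀ᶠ r in atTop, Real.log r - C ≤ ValueDistribution.characteristic f ⊤ r)
    (hs : ∀ᶠ r in atTop, r < s r ∧ s r ≤ r ^ 2)
    (hTρ : ∀ ρ' > ρ, ∀ᶠ r in atTop, ValueDistribution.characteristic f ⊤ r ≤ φ r ^ ρ')
    (hγ : growthGamma φ s = (γ : EReal)) : γ ≤ ρ := by
  refine le_of_forall_lt_imp_le_of_dense fun γ' h => ?_
  refine le_of_forall_gt_imp_ge_of_dense fun ρ' h' => ?_
  apply le_of_eventually_rpow_le hφ (c := 2)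
  filter_upwards [hT, hs, hTρ ρ' h', eventually_rpow_le_log_div hφ (hs.mono fun _ h => h.1) hγ h,
    Real.tendsto_log_atTop.eventually_ge_atTop (2 * C), eventually_gt_atTop 0]
    with r h1 h2 h3 h4 h5 h6
  have h7 : Real.log (s r / r) ≤ Real.log r := by
    apply Real.log_le_log (div_pos (by linarith [h2.1]) h6)
    rw [div_le_iff₀ h6, ← sq]
    exact h2.2
  linarith

theorem eventually_rpow_le_rpow {φ : ℝ → ℝ} (hφ : Tendsto φ atTop atTop)
    (hlog : Tendsto (fun r => Real.log (φ r) / Real.log r) atTop (𝓝 0)) {a b : ℝ} (ha : 0 < a)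
    (hb : 0 < b) : ∀ᶠ r in atTop, φ r ^ a ≤ r ^ b := by
  filter_upwards [hlog.eventually_lt_const (div_pos hb ha), hφ.eventually_gt_atTop 0,
    eventually_gt_atTop 1] with r h1 h2 h3
  rw [div_lt_div_iff₀ (Real.log_pos h3) ha] at h1
  rw [← Real.log_le_log_iff (Real.rpow_pos_of_pos h2 _) (Real.rpow_pos_of_pos (by linarith) _),
    Real.log_rpow h2, Real.log_rpow (by linarith)]
  linarith

/-- Doubling the radius gives a count of order `r^(1/4)`; the spare factor `r^(1/4)` in `√r` absorbs
all constants. -/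
theorem eventually_zpCount_le_sqrt {f : ℂ → ℂ} (hf : Meromorphic f)
    (hT : ∀ᶠ r in atTop, ValueDistribution.characteristic f ⊤ r ≤ r ^ (1 / 4 : ℝ)) {A : ℝ}
    (hA : 0 < A) : ∀ᶠ r in atTop, zpCount f (A * r) ≤ √r := by
  obtain ⟨C, hC⟩ := zpCount_mul_log_le hf
  have hlin : Tendsto (fun r : ℝ => 2 * (A * r)) atTop atTop :=
    (tendsto_id.const_mul_atTop hA).const_mul_atTop two_pos
  have h14 := (tendsto_rpow_atTop (show (0 : ℝ) < 1 / 4 by norm_num)).eventually_ge_atTop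
    (2 * (2 * (2 * A) ^ (1 / 4 : ℝ) + |C|))
  filter_upwards [hlin.eventually hT, hlin.eventually_ge_atTop 2, h14, eventually_ge_atTop 1]
    with r h1 h2 h3 hr1
  have h4 := hC (A * r) (2 * (A * r)) (by linarith) (by linarith)
  rw [mul_div_assoc, div_self (by linarith), mul_one] at h4
  have hn := zpCount_nonneg f (A * r)
  have h5 : (1 / 2 : ℝ) ≤ Real.log 2 := by linarith [Real.log_two_gt_d9]
  have e1 : (2 * (A * r)) ^ (1 / 4 : ℝ) = (2 * A) ^ (1 / 4 : ℝ) * r ^ (1 / 4 : ℝ) := by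
    rw [← mul_assoc, Real.mul_rpow (by positivity) (by linarith)]
  have h6 := Real.one_le_rpow hr1 (show (0 : ℝ) ≤ 1 / 4 by norm_num)
  have e2 : √r = r ^ (1 / 4 : ℝ) * r ^ (1 / 4 : ℝ) := by
    rw [Real.sqrt_eq_rpow, ← Real.rpow_add (by linarith)]
    norm_num
  rw [e1] at h1
  rw [e2]
  set t := r ^ (1 / 4 : ℝ)
  set b := (2 * A) ^ (1 / 4 : ℝ)
  have h7 : zpCount f (A * r) * (1 / 2) ≤ zpCount f (A * r) * Real.log 2 := by gcongr
  have h8 : C ≤ |C| * t := (le_abs_self C).trans (le_mul_of_one_le_right (abs_nonneg _) h6)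
  have h9 : 2 * (2 * b + |C|) * t ≤ t * t := by gcongr
  linarith

theorem isBigO_rpow_div_log {φ s : ℝ → ℝ} {ρ α γ ε : ℝ} (hφ : Tendsto φ atTop atTop)
    (hs : Tendsto s atTop atTop) (hsr : ∀ᶠ r in atTop, r < s r)
    (hs1 : 1 < liminf (fun r : ℝ => ((s r / r : ℝ) : EReal)) atTop)
    (hα : growthAlpha φ s = (α : EReal)) (hγ : growthGamma φ s = (γ : EReal))
    (hα0 : 0 < α) (hα1 : α ≤ 1) (hγρ : γ ≤ ρ) (hε : 0 < ε) :
    (fun r : ℝ => φ (s r) ^ (ρ + ε / 2) / Real.log (s r / r) + 1) =O[atTop]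
      (fun r : ℝ => φ (s r) ^ (ρ - α * γ + ε)) := by
  have hγ0 := growthGamma_nonneg hφ hs1 hγ
  have hexp : 0 ≤ ρ - α * γ + ε := by nlinarith
  have hφs : Tendsto (fun r => φ (s r)) atTop atTop := hφ.comp hs
  have hkey : ∃ c : ℝ, 0 < c ∧ ∀ᶠ r in atTop,
      c * φ (s r) ^ (α * γ - ε / 2) ≤ Real.log (s r / r) := by
    rcases hγ0.lt_or_eq with hγp | hγz
    -- The first two bounds keep `α - δ` and `γ - δ` positive; the third gives `(α - δ)(γ - δ) ≥ αγ
    -- - ε/2`.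
    · set δ := min (min (α / 2) (γ / 2)) (ε / (2 * (α + γ))) with hδ
      have hδ0 : 0 < δ := by
        rw [hδ]
        refine lt_min (lt_min ?_ ?_) ?_ <;> positivity
      have hδα : δ ≤ α / 2 := (min_le_left _ _).trans (min_le_left _ _)
      have hδγ : δ ≤ γ / 2 := (min_le_left _ _).trans (min_le_right _ _)
      have hδε : δ * (2 * (α + γ)) ≤ ε := by
        rw [← le_div_iff₀ (by positivity)]
        exact min_le_right _ _
      refine ⟨1, one_pos, ?_⟩
      filter_upwards [eventually_rpow_comp_le hφ hs hα (show α - δ < α by linarith),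
        eventually_rpow_le_log_div hφ hsr hγ (show γ - δ < γ by linarith),
        hφs.eventually_ge_atTop 1] with r h1 h2 h3
      rw [one_mul]
      calc φ (s r) ^ (α * γ - ε / 2) ≤ φ (s r) ^ ((α - δ) * (γ - δ)) := by
            apply Real.rpow_le_rpow_of_exponent_le h3
            nlinarith
        _ = (φ (s r) ^ (α - δ)) ^ (γ - δ) := Real.rpow_mul (by linarith) _ _
        _ ≤ φ r ^ (γ - δ) := by
            apply Real.rpow_le_rpow (Real.rpow_nonneg (by linarith) _) h1 (by linarith)
        _ ≤ _ := h2
    -- If `γ = 0`, the exponent `γ - δ` would be negative and reverse the comparison of powers; a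
    -- positive lower bound for `log(s(r)/r)` suffices instead.
    · obtain ⟨c, hc1, hc⟩ := EReal.lt_iff_exists_real_btwn.1 hs1
      have hc1' : 1 < c := by exact_mod_cast hc1
      refine ⟨Real.log c, Real.log_pos hc1', ?_⟩
      filter_upwards [eventually_lt_of_lt_liminf hc, hφs.eventually_ge_atTop 1] with r hr h3
      have hsr : c < s r / r := by exact_mod_cast hr
      have h4 : φ (s r) ^ (α * γ - ε / 2) ≤ 1 := by
        apply Real.rpow_le_one_of_one_le_of_nonpos h3
        rw [← hγz]; linarith
      have h5 := Real.log_le_log (by linarith) hsr.le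
      have h6 := Real.log_pos hc1'
      nlinarith
  obtain ⟨c, hc, hkey⟩ := hkey
  apply IsBigO.of_bound (1 / c + 1)
  filter_upwards [hkey, hφs.eventually_ge_atTop 1] with r h1 h2
  have h0 : 0 < φ (s r) := by linarith
  have hp : 0 < φ (s r) ^ (α * γ - ε / 2) := Real.rpow_pos_of_pos h0 _
  have hlog : 0 < Real.log (s r / r) := lt_of_lt_of_le (by positivity) h1
  have hq : 0 < φ (s r) ^ (ρ + ε / 2) := Real.rpow_pos_of_pos h0 _
  have hone := Real.one_le_rpow h2 hexp
  rw [Real.norm_of_nonneg (by positivity), Real.norm_of_nonneg (by positivity)]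
  have h3 : φ (s r) ^ (ρ + ε / 2) / Real.log (s r / r) ≤ 1 / c * φ (s r) ^ (ρ - α * γ + ε) := by
    rw [div_le_iff₀ hlog]
    calc φ (s r) ^ (ρ + ε / 2)
        = 1 / c * φ (s r) ^ (ρ - α * γ + ε) * (c * φ (s r) ^ (α * γ - ε / 2)) := by
          have : φ (s r) ^ (ρ + ε / 2)
              = φ (s r) ^ (ρ - α * γ + ε) * φ (s r) ^ (α * γ - ε / 2) := by
            rw [← Real.rpow_add h0]
            congr 1
            ring
          rw [this]
          field_simp
      _ ≤ _ := by gcongr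
  linarith

/-! ### Choice of the outer radius and conclusion -/

theorem tendsto_norm_cobddOutside (E : Set ℝ) :
    Tendsto (fun x : ℂ => ‖x‖) (cobddOutside E) atTop :=
  tendsto_norm_cobounded_atTop.mono_left inf_le_left

theorem isBigO_cobddOutside_of_eventually {E : Set ℝ} {u : ℂ → ℝ} {v : ℝ → ℝ} (c : ℝ)
    (h : ∀ᶠ r in atTop, r ∉ E → ∀ x : ℂ, ‖x‖ = r → ‖u x‖ ≤ c * v r) :
    u =O[cobddOutside E] fun x => v ‖x‖ := by
  apply IsBigO.of_bound |c|
  have hmem : ∀ᶠ x in cobddOutside E, ‖x‖ ∉ E := mem_inf_of_right (mem_principal_self _)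
  filter_upwards [(tendsto_norm_cobddOutside E).eventually h, hmem] with x h1 h2
  refine (h1 h2 x rfl).trans ((le_abs_self _).trans ?_)
  rw [abs_mul, Real.norm_eq_abs]

theorem eventually_comp_mul_le_of_subadditive {φ : ℝ → ℝ} {R₁ : ℝ}
    (hsub : ∀ a b : ℝ, R₁ ≤ a → R₁ ≤ b → φ (a + b) ≤ φ a + φ b) (m : ℕ) :
    ∀ᶠ r in atTop, φ (2 ^ m * r) ≤ 2 ^ m * φ r := by
  filter_upwards [eventually_ge_atTop R₁, eventually_ge_atTop 0] with r hr hr0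
  induction m with
  | zero => simp
  | succ m ih =>
    have h1 : R₁ ≤ 2 ^ m * r := hr.trans (le_mul_of_one_le_left hr0 (one_le_pow₀ one_le_two))
    have h2 := hsub _ _ h1 h1
    rw [pow_succ, show (2 : ℝ) ^ m * 2 * r = 2 ^ m * r + 2 ^ m * r by ring]
    linarith

/-- With `R = √(r s(r))` and `σ = s(r)/r`, one has `r/R = 1/√σ ≤ 2/log σ` and `log(s(r)/R) = (log
σ)/2`, so the kernel term and the count both gain `1/log σ`. Of the exponent `ε/2`, one half comes
from the bound on `T` and the other absorbs `log log r`. The hypothesis `s(r)/r → ∞` ensures `R ≥ K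
r`. -/
theorem eventually_bound_of_tendsto {φ s : ℝ → ℝ} {f : ℂ → ℂ} {ρ ε : ℝ} (hf : Meromorphic f)
    (hφ : Tendsto φ atTop atTop) (hφ_log : ∀ᶠ r in atTop, Real.log r ≤ φ r) {R₀ : ℝ}
    (hφ_mono : MonotoneOn φ (Ioi R₀)) (hs : Tendsto (fun r => s r / r) atTop atTop)
    (hsr : ∀ᶠ r in atTop, r < s r) (hρ : 0 ≤ ρ) (hε : 0 < ε)
    (hT : ∀ᶠ r in atTop, ValueDistribution.characteristic f ⊤ r ≤ φ r ^ (ρ + ε / 4))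
    (K : ℝ) : ∃ c : ℝ, ∀ᶠ r in atTop, K * r ≤ √(r * s r) ∧
      1 + r / √(r * s r) * (ValueDistribution.characteristic f ⊤ √(r * s r) + 1)
          + (1 + Real.log (Real.log r)) * zpCount f √(r * s r)
        ≤ c * (φ (s r) ^ (ρ + ε / 2) / Real.log (s r / r) + 1) := by
  obtain ⟨C, hC⟩ := zpCount_mul_log_le hf
  have hst : Tendsto s atTop atTop := tendsto_atTop_mono' _ (hsr.mono fun _ h => h.le) tendsto_id
  set δ := ε / 4 with hδ
  have hδ0 : 0 < δ := by positivity
  refine ⟨4 + (1 + 1 / δ) * (4 + 2 * |C|) + 1, ?_⟩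
  have hRt : Tendsto (fun r => √(r * s r)) atTop atTop := by
    apply tendsto_atTop_mono' _ _ tendsto_id
    filter_upwards [hsr, eventually_ge_atTop 0] with r h1 h2
    apply Real.le_sqrt_of_sq_le
    simp only [id]
    nlinarith
  filter_upwards [hsr, hs.eventually_ge_atTop (K ^ 2), hRt.eventually hT, hst.eventually hT,
    hφ_log, (hφ.comp hst).eventually_ge_atTop 1, eventually_gt_atTop R₀,
    eventually_ge_atTop (Real.exp 1), hRt.eventually_gt_atTop R₀]
    with r h1 h2 h3 h4 h5 h6 h7 h8 h9
  simp only [Function.comp_apply] at h6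
  have hr1 : 1 < r := lt_of_lt_of_le (by
    have := Real.add_one_lt_exp (show (1 : ℝ) ≠ 0 by norm_num); linarith) h8
  have hr0 : 0 < r := by linarith
  have hlog1 : 1 ≤ Real.log r := by
    rw [Real.le_log_iff_exp_le hr0]; exact h8
  have hs0 : 0 < s r := by linarith
  set σ := s r / r with hσ
  have hsσ : s r = σ * r := by rw [hσ]; field_simp
  have hσ1 : 1 < σ := by rw [hσ, lt_div_iff₀ hr0]; linarith
  have hlσ : 0 < Real.log σ := Real.log_pos hσ1
  set R := √(r * s r) with hR
  have hRσ : R = r * √σ := by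
    rw [hR, hsσ, show r * (σ * r) = r ^ 2 * σ by ring, Real.sqrt_mul (sq_nonneg r),
      Real.sqrt_sq hr0.le]
  have hqσ : 1 ≤ √σ := Real.one_le_sqrt.2 hσ1.le
  have hrR : r ≤ R := by rw [hRσ]; exact le_mul_of_one_le_right hr0.le hqσ
  have hR0 : 0 < R := by linarith
  have hRs : R ≤ s r := by
    rw [hRσ, hsσ, mul_comm]
    apply mul_le_mul_of_nonneg_right _ hr0.le
    nlinarith [Real.mul_self_sqrt (show 0 ≤ σ by linarith)]
  refine ⟨?_, ?_⟩
  · rw [hRσ, mul_comm]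
    apply mul_le_mul_of_nonneg_left _ hr0.le
    exact Real.le_sqrt_of_sq_le h2
  have hφR : φ R ≤ φ (s r) := hφ_mono h9 (lt_of_lt_of_le h9 hRs) hRs
  have hφrs : φ r ≤ φ (s r) := hφ_mono h7 (lt_trans h7 h1) h1.le
  have hφR0 : 0 ≤ φ R := le_trans (by linarith) (h5.trans (hφ_mono h7 h9 hrR))
  set y := φ (s r) with hy
  set Y := y ^ (ρ + δ) with hY
  have hY1 : 1 ≤ Y := Real.one_le_rpow h6 (by linarith)
  have hTR : ValueDistribution.characteristic f ⊤ R ≤ Y :=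
    h3.trans (Real.rpow_le_rpow hφR0 hφR (by linarith))
  have hsR : Real.log (s r / R) = Real.log σ / 2 := by
    have e : s r / R = √σ := by
      rw [hRσ, hsσ, div_eq_iff (by positivity)]
      nlinarith [Real.mul_self_sqrt (show 0 ≤ σ by linarith)]
    rw [e, Real.log_sqrt (by linarith)]
  have hn := hC R (s r) (by linarith) hRs
  rw [hsR] at hn
  have hn' : zpCount f R ≤ (4 + 2 * |C|) * Y / Real.log σ := by
    rw [le_div_iff₀ hlσ]
    have h10 : C ≤ |C| * Y := (le_abs_self C).trans (le_mul_of_one_le_right (abs_nonneg _) hY1)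
    linarith
  have hll : 1 + Real.log (Real.log r) ≤ (1 + 1 / δ) * y ^ δ := by
    have h10 : Real.log (Real.log r) ≤ Real.log y :=
      Real.log_le_log (by linarith) (h5.trans hφrs)
    linarith [one_add_log_le hδ0 h6]
  have hyδ : 1 ≤ y ^ δ := Real.one_le_rpow h6 hδ0.le
  have e2 : y ^ (ρ + ε / 2) = Y * y ^ δ := by
    rw [hY, ← Real.rpow_add (by linarith)]
    congr 1
    rw [hδ]; ring
  have hfrac : r / R ≤ 2 / Real.log σ := by
    rw [hRσ, div_le_div_iff₀ (by positivity) hlσ]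
    have h10 := Real.log_le_sub_one_of_pos (show 0 < √σ by linarith)
    rw [Real.log_sqrt (by linarith)] at h10
    have h11 : Real.log σ ≤ 2 * √σ := by linarith
    nlinarith
  have h12 : r / R * (ValueDistribution.characteristic f ⊤ R + 1) ≤
      4 * (Y * y ^ δ / Real.log σ) := by
    have h13 : ValueDistribution.characteristic f ⊤ R + 1 ≤ 2 * (Y * y ^ δ) := by
      have := le_mul_of_one_le_right (show 0 ≤ Y by linarith) hyδ
      linarith
    have h14 : 0 ≤ ValueDistribution.characteristic f ⊤ R :=
      ValueDistribution.characteristic_nonneg (by linarith)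
    calc _ ≤ 2 / Real.log σ * (2 * (Y * y ^ δ)) := by gcongr
      _ = _ := by ring
  have h15 : (1 + Real.log (Real.log r)) * zpCount f R ≤
      (1 + 1 / δ) * (4 + 2 * |C|) * (Y * y ^ δ / Real.log σ) := by
    calc _ ≤ ((1 + 1 / δ) * y ^ δ) * ((4 + 2 * |C|) * Y / Real.log σ) := by
          gcongr
          exact zpCount_nonneg f R
      _ = _ := by ring
  rw [e2]
  set X := Y * y ^ δ / Real.log σ with hX
  have hX0 : 0 ≤ X := by positivity
  have h16 : 0 ≤ (1 + 1 / δ) * (4 + 2 * |C|) := by positivity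
  clear_value X
  linarith

/-- A bounded dilation of `r` suffices here: with `2^m > 2 K`, repeated doubling gives `φ(t) ≤ 2^m
φ(r)` up to `t = 2 K r`, so `T(K r)` and `n(K r)` are both `O(φ(r)^(ρ + ε/4))`. -/
theorem eventually_bound_of_subadditive {φ : ℝ → ℝ} {f : ℂ → ℂ} {ρ ε : ℝ} (hf : Meromorphic f)
    (hφ : Tendsto φ atTop atTop) (hφ_log : ∀ᶠ r in atTop, Real.log r ≤ φ r) {R₀ : ℝ}
    (hφ_mono : MonotoneOn φ (Ioi R₀)) (hρ : 0 ≤ ρ) (hε : 0 < ε)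
    (hsub : ∃ R₁ : ℝ, ∀ a b : ℝ, R₁ ≤ a → R₁ ≤ b → φ (a + b) ≤ φ a + φ b)
    (hT : ∀ᶠ r in atTop, ValueDistribution.characteristic f ⊤ r ≤ φ r ^ (ρ + ε / 4)) {K : ℝ}
    (hK : 1 ≤ K) : ∃ c : ℝ, ∀ᶠ r in atTop,
      1 + r / (K * r) * (ValueDistribution.characteristic f ⊤ (K * r) + 1)
          + (1 + Real.log (Real.log r)) * zpCount f (K * r)
        ≤ c * φ r ^ (ρ + ε) := by
  obtain ⟨C, hC⟩ := zpCount_mul_log_le hf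
  obtain ⟨R₁, hR₁⟩ := hsub
  obtain ⟨m, hm⟩ := pow_unbounded_of_one_lt (2 * K) (one_lt_two (α := ℝ))
  set δ := ε / 4 with hδ
  have hδ0 : 0 < δ := by positivity
  set b : ℝ := ((2 : ℝ) ^ m) ^ (ρ + δ) with hb
  have hb0 : 0 ≤ b := by positivity
  refine ⟨2 + b + (1 + 1 / δ) * (2 * (2 * b + |C|)), ?_⟩
  have hKt : Tendsto (fun r => K * r) atTop atTop := tendsto_id.const_mul_atTop (by linarith)
  have hKt2 : Tendsto (fun r => 2 * (K * r)) atTop atTop := hKt.const_mul_atTop two_pos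
  filter_upwards [hKt.eventually hT, hKt2.eventually hT, hφ_log, hφ.eventually_ge_atTop 1,
    eventually_gt_atTop R₀, eventually_ge_atTop (Real.exp 1),
    eventually_comp_mul_le_of_subadditive hR₁ m] with r h1 h2 h3 h4 h5 h6 h7
  have hr1 : 1 < r := lt_of_lt_of_le (by
    have := Real.add_one_lt_exp (show (1 : ℝ) ≠ 0 by norm_num); linarith) h6
  have hr0 : 0 < r := by linarith
  have hlog1 : 1 ≤ Real.log r := by
    rw [Real.le_log_iff_exp_le hr0]; exact h6
  set y := φ r with hy
  have hKr : r ≤ K * r := le_mul_of_one_le_left hr0.le hK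
  have hφle : ∀ t, r ≤ t → t ≤ 2 * (K * r) → φ t ^ (ρ + δ) ≤ b * y ^ (ρ + δ) := by
    intro t ht ht'
    have h8 : t ≤ 2 ^ m * r := ht'.trans (by
      rw [← mul_assoc]; exact mul_le_mul_of_nonneg_right hm.le hr0.le)
    have h9 : φ t ≤ 2 ^ m * y :=
      (hφ_mono (lt_of_lt_of_le h5 ht) (lt_of_lt_of_le h5 (ht.trans h8)) h8).trans h7
    have h10 : 0 ≤ φ t := by
      have := hφ_mono h5 (lt_of_lt_of_le h5 ht) ht
      linarith
    rw [hb, ← Real.mul_rpow (by positivity) (by linarith)]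
    exact Real.rpow_le_rpow h10 h9 (by linarith)
  have hT1 := h1.trans (hφle _ hKr (by linarith))
  have hT2 := h2.trans (hφle _ (by linarith) le_rfl)
  set Y := y ^ (ρ + δ) with hY
  have hY1 : 1 ≤ Y := Real.one_le_rpow h4 (by linarith)
  have hn := hC (K * r) (2 * (K * r)) (by linarith) (by linarith)
  rw [mul_div_assoc, div_self (by linarith), mul_one] at hn
  have h11 : (1 / 2 : ℝ) ≤ Real.log 2 := by linarith [Real.log_two_gt_d9]
  have hn0 := zpCount_nonneg f (K * r)
  have h12 : zpCount f (K * r) * (1 / 2) ≤ zpCount f (K * r) * Real.log 2 := by gcongr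
  have h10 : C ≤ |C| * Y := (le_abs_self C).trans (le_mul_of_one_le_right (abs_nonneg _) hY1)
  have hn' : zpCount f (K * r) ≤ (2 * (2 * b + |C|)) * Y := by linarith
  have hll : 1 + Real.log (Real.log r) ≤ (1 + 1 / δ) * y ^ δ := by
    have h10 : Real.log (Real.log r) ≤ Real.log y := Real.log_le_log (by linarith) h3
    linarith [one_add_log_le hδ0 h4]
  have hyδ : 1 ≤ y ^ δ := Real.one_le_rpow h4 hδ0.le
  have e2 : Y * y ^ δ ≤ y ^ (ρ + ε) := by
    rw [hY, ← Real.rpow_add (by linarith)]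
    apply Real.rpow_le_rpow_of_exponent_le h4
    rw [hδ]; linarith
  have hYY : Y ≤ Y * y ^ δ := le_mul_of_one_le_right (by linarith) hyδ
  have hT0 : 0 ≤ ValueDistribution.characteristic f ⊤ (K * r) :=
    ValueDistribution.characteristic_nonneg (by linarith)
  have h13 : r / (K * r) * (ValueDistribution.characteristic f ⊤ (K * r) + 1) ≤ b * Y + 1 := by
    have h14 : r / (K * r) ≤ 1 := by rw [div_le_one (by linarith)]; exact hKr
    calc _ ≤ 1 * (ValueDistribution.characteristic f ⊤ (K * r) + 1) := by gcongr
      _ ≤ _ := by linarith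
  have h15 : (1 + Real.log (Real.log r)) * zpCount f (K * r) ≤
      (1 + 1 / δ) * (2 * (2 * b + |C|)) * (Y * y ^ δ) := by
    calc _ ≤ ((1 + 1 / δ) * y ^ δ) * ((2 * (2 * b + |C|)) * Y) := by gcongr
      _ = _ := by ring
  set Z := y ^ (ρ + ε) with hZ
  have h16 : (1 + 1 / δ) * (2 * (2 * b + |C|)) * (Y * y ^ δ) ≤
      (1 + 1 / δ) * (2 * (2 * b + |C|)) * Z := by gcongr
  have h17 : b * Y ≤ b * Z := by gcongr; linarith
  linarith

theorem lemma3p2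
    -- the base `q` and the fixed square root `p = q^{1/2}`
    (q p : ℂ) (hq0 : 0 < ‖q‖) (hq1 : ‖q‖ < 1) (hp : p ^ 2 = q)
    -- the comparison function `φ : (R₀, ∞) → (0, ∞)`
    (R₀ : ℝ) (φ : ℝ → ℝ)
    (hφ_pos : ∀ r ∈ Ioi R₀, 0 < φ r)
    (hφ_mono : MonotoneOn φ (Ioi R₀))
    (hφ_unbdd : ¬ BddAbove (φ '' Ioi R₀))
    (hφ_bounds : ∀ᶠ r in atTop, Real.log r ≤ φ r ∧ φ r ≤ r)
    -- the function `s : (R₀, ∞) → (0, ∞)`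
    (s : ℝ → ℝ)
    (hs_pos : ∀ r ∈ Ioi R₀, 0 < s r)
    (hs_mono : MonotoneOn s (Ioi R₀))
    (hs_bounds : ∀ᶠ r in atTop, r < s r ∧ s r ≤ r ^ 2)
    (hs_liminf : 1 < liminf (fun r : ℝ => ((s r / r : ℝ) : EReal)) atTop)
    -- the meromorphic function, of finite `φ`-order `ρ`, with `𝒟_q f ≢ 0`
    (f : ℂ → ℂ) (hf : Meromorphic f)
    (ρ : ℝ) (hρ : phiOrder φ f = (ρ : EReal))
    (hDf : ¬ (awOperator p f =ᶠ[codiscrete ℂ] 0))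
    -- the growth parameters
    (α γ : ℝ) (hα : growthAlpha φ s = (α : EReal)) (hγ : growthGamma φ s = (γ : EReal))
    (hα_pos : 0 < α)
    (hφ_cont : ContinuousOn φ (Ioi R₀))
    (hφ_log : Tendsto (fun r => Real.log (φ r) / Real.log r) atTop (𝓝 0))
    (ε : ℝ) (hε : 0 < ε) :
    -- case (a)
    (limsup (fun r : ℝ => ((s r / r : ℝ) : EReal)) atTop = ⊤ →
      ConvexOn ℝ (Ioi R₀) s → DifferentiableOn ℝ s (Ioi R₀) →
      ∃ E : Set ℝ, FiniteLogMeasure E ∧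
        (fun x : ℂ => Real.posLog ‖awOperator p f x / f x‖) =O[cobddOutside E]
          (fun x : ℂ => φ (s ‖x‖) ^ (ρ + ε / 2) / Real.log (s ‖x‖ / ‖x‖) + 1) ∧
        (fun r : ℝ => φ (s r) ^ (ρ + ε / 2) / Real.log (s r / r) + 1) =O[atTop]
          (fun r : ℝ => φ (s r) ^ (ρ - α * γ + ε)) ∧
        (fun x : ℂ => Real.posLog ‖awOperator p f x / f x‖) =O[cobddOutside E]
          (fun x : ℂ => φ (s ‖x‖) ^ (ρ - α * γ + ε))) ∧
    -- case (b)
    (limsup (fun r : ℝ => ((s r / r : ℝ) : EReal)) atTop < ⊤ →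
      (∃ R₁ : ℝ, ∀ a b : ℝ, R₁ ≤ a → R₁ ≤ b → φ (a + b) ≤ φ a + φ b) →
      ∃ E : Set ℝ, FiniteLogMeasure E ∧
        (fun x : ℂ => Real.posLog ‖awOperator p f x / f x‖) =O[cobddOutside E]
          (fun x : ℂ => φ ‖x‖ ^ (ρ + ε))) := by
  have hp0 : p ≠ 0 := by
    rintro rfl
    rw [← hp] at hq0
    norm_num at hq0
  have hp1 : ‖p‖ < 1 := by
    rw [← hp, norm_pow] at hq1
    exact (pow_lt_one_iff_of_nonneg (norm_nonneg p) two_ne_zero).1 hq1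
  have hφ_ge : ∀ᶠ r in atTop, Real.log r ≤ φ r := hφ_bounds.mono fun _ h => h.1
  have hφ : Tendsto φ atTop atTop := tendsto_atTop_mono' _ hφ_ge Real.tendsto_log_atTop
  have hsr : ∀ᶠ r in atTop, r < s r := hs_bounds.mono fun _ h => h.1
  have hst : Tendsto s atTop atTop := tendsto_atTop_mono' _ (hsr.mono fun _ h => h.le) tendsto_id
  have hφs : ∀ᶠ r in atTop, φ r ≤ φ (s r) := by
    filter_upwards [hsr, eventually_gt_atTop R₀] with r h1 h2
    exact hφ_mono h2 (lt_trans h2 h1) h1.le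
  have hconst : ∀ c : ℂ, ¬ f =ᶠ[codiscrete ℂ] fun _ => c := fun c hc =>
    hDf (awOperator_eq_zero_of_const hp0 hc)
  have hne : ∀ z, meromorphicOrderAt f z ≠ ⊤ := by
    simpa using meromorphicOrderAt_sub_const_ne_top hf hconst 0
  obtain ⟨C, hC⟩ := exists_log_le_characteristic hf hconst
  have hTpos : ∀ᶠ r in atTop, 0 < ValueDistribution.characteristic f ⊤ r := by
    filter_upwards [hC, Real.tendsto_log_atTop.eventually_gt_atTop C] with r h1 h2
    linarith
  have hTρ : ∀ ρ' > ρ, ∀ᶠ r in atTop, ValueDistribution.characteristic f ⊤ r ≤ φ r ^ ρ' :=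
    fun ρ' h => eventually_characteristic_le_rpow hφ hTpos hρ h
  have hγρ : γ ≤ ρ := growthGamma_le_phiOrder hφ hC hs_bounds hTρ hγ
  have hρ0 : 0 ≤ ρ := (growthGamma_nonneg hφ hs_liminf hγ).trans hγρ
  have hα1 : α ≤ 1 := growthAlpha_le_one hφ hst hφs hα
  have hTε := hTρ (ρ + ε / 4) (by linarith)
  -- Here `log φ(r) / log r → 0` enters: any power of `φ`, hence `T`, is eventually below `r^(1/4)`.
  have hgrow : ∀ A : ℝ, 0 < A → ∀ᶠ r in atTop, zpCount f (A * r) ≤ √r := by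
    intro A hA
    apply eventually_zpCount_le_sqrt hf _ hA
    filter_upwards [hTε, eventually_rpow_le_rpow hφ hφ_log (show 0 < ρ + ε / 4 by linarith)
      (show (0 : ℝ) < 1 / 4 by norm_num)] with r h1 h2 using h1.trans h2
  obtain ⟨E, hE, K, c, hK, hc, hmain⟩ := exists_posLog_awOperator_div_le hp0 hp1 hf hne hgrow
  constructor
  · intro hlim hconv _
    have hstend := tendsto_div_atTop_of_convexOn hs_pos hlim hconv
    obtain ⟨c', hc'⟩ := eventually_bound_of_tendsto hf hφ hφ_ge hφ_mono hstend hsr hρ0 hε hTε K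
    have h1 : (fun x : ℂ => Real.posLog ‖awOperator p f x / f x‖) =O[cobddOutside E]
        (fun x : ℂ => φ (s ‖x‖) ^ (ρ + ε / 2) / Real.log (s ‖x‖ / ‖x‖) + 1) := by
      apply isBigO_cobddOutside_of_eventually
        (v := fun r => φ (s r) ^ (ρ + ε / 2) / Real.log (s r / r) + 1) (c * c')
      filter_upwards [hmain, hc'] with r h1 h2 hrE x hx
      rw [Real.norm_of_nonneg Real.posLog_nonneg, mul_assoc]
      exact (h1 hrE x hx _ h2.1).trans (mul_le_mul_of_nonneg_left h2.2 hc)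
    have h2 := isBigO_rpow_div_log hφ hst hsr hs_liminf hα hγ hα_pos hα1 hγρ hε
    exact ⟨E, hE, h1, h2, h1.trans (h2.comp_tendsto (tendsto_norm_cobddOutside E))⟩
  · intro _ hsub
    obtain ⟨c', hc'⟩ := eventually_bound_of_subadditive hf hφ hφ_ge hφ_mono hρ0 hε hsub hTε hK
    refine ⟨E, hE, isBigO_cobddOutside_of_eventually (v := fun r => φ r ^ (ρ + ε)) (c * c') ?_⟩
    filter_upwards [hmain, hc'] with r h1 h2 hrE x hx
    rw [Real.norm_of_nonneg Real.posLog_nonneg, mul_assoc]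
    exact (h1 hrE x hx _ le_rfl).trans (mul_le_mul_of_nonneg_left h2 hc)
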